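/- A \emph{degree sequence} is a polynomial $Q(x)=\sum_{l\ge 2}Q_l x^l$ with real coefficients $Q_l\ge 0$ and $Q(1)=1$. Let $(\Lambda,P)$ be a pair of degree sequences, let $l_{\max}$ and $k_{\max}$ be the degrees of $\Lambda$ and $P$, and let $0<\gamma<1$. \textbf{Multi-Poisson ensemble.} Given class sizes $N_l\in\mathbb{N}$ ($0\le l\le l_{\max}$), let $n=\sum_l N_l$ and partition the variable nodes $[n]$ uniformly at random into classes $V_l$ with $|V_l|=N_l$. (The multi-Poisson ensemble $(n,\Lambda,P,\gamma)$ is the case $N_l=n\Lambda_l$.) Put $\mathsf d_i(0)=l$ for $i\in V_l$, and start from the graph without check nodes. Perform $t_{\max}=\lfloor \Lambda'(1)/\gamma\rfloor-1$ rounds. In round $t=0,\dots,t_{\max}-1$, for each $2\le k\le k_{\max}$ independently, add a Poisson number, with mean $n\gamma P_k/P'(1)$, of check nodes of degree $k$, and join each of them to $k$ variable nodes drawn independently with probabilities $w_i(t)=[\mathsf d_i(t)]_+/\sum_j[\mathsf d_j(t)]_+$; multiple edges are allowed, and no check node is added if $\sum_j[\mathsf d_j(t)]_+=0$. Then put $\mathsf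 d_i(t+1)=\mathsf d_i(t)-\Delta_i(t)$, where $\Delta_i(t)$ is the number of times $i$ was drawn in round $t$. For $l\ge 0$ let $\hat\Lambda_l$ be the fraction of variable nodes of degree $l$ (edges counted with multiplicity) in the final graph. \textbf{Statement.} For every $l\ge 0$ the limit $$\Lambda^{(\gamma)}_l=\lim \mathbb{E}\,\hat\Lambda_l$$ exists, where the limit is taken over class sizes with $n\to\infty$ and $N_l/n\to\Lambda_l$ for all $l\le l_{\max}$ (in particular along $N_l=n\Lambda_l$ if these numbers are integers for infinitely many $n$). There are constants $A,b>0$ which depend only on $(\Lambda,P)$ such that, for all $0<\gamma<1$ and all $l\in\{2,\dots,l_{\max}\}$, $$|\Lambda^{(\gamma)}_l-\Lambda_l|\le A\,\gamma^{b}.$$ Moreover $\sum_{l\ge 0}|\Lambda^{(\gamma)}_l-\Lambda_l|<\infty$ for every $0<\gamma<1$, and $$\lim_{\gamma\to 0^+}\ \frac12\sum_{l\ge 0}|\Lambda^{(\gamma)}_l-\Lambda_l|=0 .$$ -/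

import Mathlib

open Filter Topology Polynomial ProbabilityTheory
open scoped NNReal ENNReal

noncomputable section

namespace MultiPoisson

/-- A design degree sequence, given by its generating polynomial `Λ(x) = ∑_{l ≥ 2} Λ_l x^l`:
non-negative coefficients, no degree below `2`, and `Λ(1) = 1`. The maximum degree is
`Λ.natDegree`. -/
structure IsDegreeSequence (Q : ℝ[X]) : Prop where
  nonneg : ∀ l, 0 ≤ Q.coeff l
  coeff_zero : Q.coeff 0 = 0
  coeff_one : Q.coeff 1 = 0
  eval_one : Q.eval 1 = 1

/-! ### Tanner graphs -/

/-- The check nodes added in one round. `R k` lists the check nodes `(â, k)`, `â = 1, 2, …`, of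
degree `k ≤ K`; each is given by its `k` neighbours `i₁, …, i_k` (repetitions allowed) among the
`n` variable nodes. -/
abbrev Round (n K : ℕ) : Type := (k : Fin (K + 1)) → List (Fin k → Fin n)

/-- A Tanner graph with variable nodes `Fin n`, built in rounds; its check nodes are labelled
`(â, k, t)`, with `t` the index of the round. -/
abbrev TannerGraph (n K : ℕ) : Type := List (Round n K)

/-- The number of times the variable node `i` has been chosen during a round. -/
def Round.count {n K : ℕ} (R : Round n K) (i : Fin n) : ℕ :=
  ∑ k : Fin (K + 1), ((R k).map fun a => (Finset.univ.filter fun r => a r = i).card).sum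

/-- The degree of the variable node `i`: the number of edges at `i`, with multiplicity. -/
def TannerGraph.degree {n K : ℕ} (G : TannerGraph n K) (i : Fin n) : ℕ :=
  (List.map (fun R : Round n K => R.count i) G).sum

/-- The left degree profile of a graph: `degreeProfile G l` is the fraction of variable nodes of
degree `l`. -/
def TannerGraph.degreeProfile {n K : ℕ} (G : TannerGraph n K) (l : ℕ) : ℝ :=
  ((Finset.univ.filter fun i : Fin n => G.degree i = l).card : ℝ) / n

/-! ### Random choices -/

/-- The law of a family of independent random variables, the `i`-th one with law `p i`. -/
def indep : (m : ℕ) → {β : Fin m → Type} → ((i : Fin m) → PMF (β i)) → PMF ((i : Fin m) → β i)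
  | 0, _, _ => PMF.pure fun i => i.elim0
  | m + 1, _, p =>
    (p 0).bind fun a => (indep m fun i => p i.succ).map fun f => Fin.cons a f

/-- The law of a list of `m` independent random variables with common law `p`. -/
def iidList {β : Type} (p : PMF β) : ℕ → PMF (List β)
  | 0 => PMF.pure []
  | m + 1 => p.bind fun a => (iidList p m).map fun L => a :: L

/-- The expectation of a (bounded) function under a discrete law. -/
def expect {β : Type} (p : PMF β) (f : β → ℝ) : ℝ := ∑' x, (p x).toReal * f x

/-- The law on the variable nodes which gives `i` the weight `[d_i]₊ / ∑_j [d_j]₊`. -/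
def biased {n : ℕ} (d : Fin n → ℤ) (h : ∃ i, 0 < d i) : PMF (Fin n) :=
  PMF.normalize (fun i => ((d i).toNat : ℝ≥0∞))
    (by
      obtain ⟨i, hi⟩ := h
      intro h0
      have := ENNReal.tsum_eq_zero.1 h0 i
      simp only [Nat.cast_eq_zero, Int.toNat_eq_zero] at this
      omega)
    (by
      rw [tsum_fintype]
      exact ENNReal.sum_ne_top.2 fun i _ => ENNReal.natCast_ne_top _)

/-! ### The ensemble -/

open Classical in
/-- The law of the check nodes added in a round in which the variable node `i` has `d i` free
sockets: for each `k`, independently, a `Poisson(n γ P_k / P'(1))` number of check nodes of degree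
`k`, each of whose `k` neighbours are drawn independently from `biased d`. If no variable node has
a free socket, then `biased d` is not defined, and no check node is added. -/
def roundLaw (n : ℕ) (P : ℝ[X]) (γ : ℝ) (d : Fin n → ℤ) : PMF (Round n P.natDegree) :=
  if h : ∃ i, 0 < d i then
    indep (P.natDegree + 1) fun k =>
      (poissonMeasure (n * γ * P.coeff k / P.derivative.eval 1).toNNReal).toPMF.bind fun m =>
        iidList (indep k fun _ => biased d h) m
  else PMF.pure fun _ => []

/-- The law of the graph `G_t` and of the free socket numbers `d_i(t)` after `t` rounds, started
from the graph without check nodes and from `d_i(0) = d₀ i`. -/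
def process (n : ℕ) (P : ℝ[X]) (γ : ℝ) (d₀ : Fin n → ℤ) :
    ℕ → PMF (TannerGraph n P.natDegree × (Fin n → ℤ))
  | 0 => PMF.pure ([], d₀)
  | t + 1 => (process n P γ d₀ t).bind fun s =>
      (roundLaw n P γ s.2).map fun R => (s.1 ++ [R], fun i => s.2 i - R.count i)

open Classical in
/-- The ordered partitions of `n = ∑ l, N l` variable nodes into classes `V_l` of sizes `N l`,
given by the map which sends each node to the index of its class. -/
def partitions {L : ℕ} (N : Fin (L + 1) → ℕ) : Finset (Fin (∑ l, N l) → Fin (L + 1)) :=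
  Finset.univ.filter fun c => ∀ l, (Finset.univ.filter fun i => c i = l).card = N l

lemma partitions_nonempty {L : ℕ} (N : Fin (L + 1) → ℕ) : (partitions N).Nonempty := by
  classical
  refine ⟨fun i => (finSigmaFinEquiv.symm i).1, ?_⟩
  simp only [partitions, Finset.mem_filter, Finset.mem_univ, true_and]
  intro l
  rw [← Fintype.card_subtype]
  have e : {i : Fin (∑ l, N l) // (finSigmaFinEquiv.symm i).1 = l} ≃ Fin (N l) :=
    (finSigmaFinEquiv.symm.subtypeEquiv
      (q := fun s : (l : Fin (L + 1)) × Fin (N l) => s.1 = l) fun i => Iff.rfl).trans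
      (Equiv.sigmaSubtype l)
  simpa using Fintype.card_congr e

/-- The number of rounds, `⌊Λ'(1)/γ⌋ - 1`. -/
def rounds (Λ : ℝ[X]) (γ : ℝ) : ℕ := ⌊Λ.derivative.eval 1 / γ⌋₊ - 1

/-- The multi-Poisson ensemble with blocklength `n = ∑ l, N l`: the variable nodes are partitioned
uniformly at random into classes `V_l` of sizes `N l`, each node of `V_l` receives `l` sockets, and
then `rounds Λ γ` rounds are performed. The design profile is `Λ` exactly when `N l = n Λ_l`. -/
def ensemble (Λ P : ℝ[X]) (γ : ℝ) (N : Fin (Λ.natDegree + 1) → ℕ) :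
    PMF (TannerGraph (∑ l, N l) P.natDegree) :=
  (PMF.uniformOfFinset (partitions N) (partitions_nonempty N)).bind fun c =>
    (process (∑ l, N l) P γ (fun i => ((c i : ℕ) : ℤ)) (rounds Λ γ)).map Prod.fst

/-- The expected left degree profile of the multi-Poisson ensemble at finite blocklength. -/
def expectedDegreeProfile (Λ P : ℝ[X]) (γ : ℝ) (N : Fin (Λ.natDegree + 1) → ℕ) (l : ℕ) : ℝ :=
  expect (ensemble Λ P γ N) fun G => G.degreeProfile l

/-- The large blocklength limit at design profile `Λ`: the blocklength `n = ∑ l, N l` tends to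
infinity and `N l / n` tends to `Λ_l`. It covers the case `N l = n Λ_l`, where these numbers are
integers, and makes sense for all real `Λ_l`. -/
def largeBlocklength (Λ : ℝ[X]) : Filter (Fin (Λ.natDegree + 1) → ℕ) :=
  comap (fun N => ∑ l, N l) atTop ⊓
    comap (fun N l => (N l : ℝ) / ((∑ k, N k : ℕ) : ℝ)) (𝓝 fun l => Λ.coeff l)

/-- Every degree sequence is approximated by class sizes of arbitrarily large blocklength, so that
limits along `largeBlocklength Λ` are unique. -/
lemma largeBlocklength_neBot {Λ : ℝ[X]} (hΛ : IsDegreeSequence Λ) :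
    (largeBlocklength Λ).NeBot := by
  have hsum : ∑ l : Fin (Λ.natDegree + 1), Λ.coeff l = 1 := by
    rw [Fin.sum_univ_eq_sum_range (fun l => Λ.coeff l) (Λ.natDegree + 1), ← hΛ.eval_one,
      Polynomial.eval_eq_sum_range]
    simp
  let N : ℕ → Fin (Λ.natDegree + 1) → ℕ := fun j l => ⌊Λ.coeff l * (j : ℝ)⌋₊
  have h1 : ∀ l, Tendsto (fun j : ℕ => (N j l : ℝ) / (j : ℝ)) atTop (𝓝 (Λ.coeff l)) := fun l =>
    (tendsto_nat_floor_mul_div_atTop (hΛ.nonneg l)).comp tendsto_natCast_atTop_atTop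
  have h2 : Tendsto (fun j : ℕ => ((∑ l, N j l : ℕ) : ℝ) / (j : ℝ)) atTop (𝓝 1) := by
    rw [← hsum]
    simp only [Nat.cast_sum, Finset.sum_div]
    exact tendsto_finsetSum _ fun l _ => h1 l
  have h3 : Tendsto (fun j : ℕ => ∑ l, N j l) atTop atTop := by
    rw [← tendsto_natCast_atTop_iff (R := ℝ)]
    refine (h2.pos_mul_atTop one_pos (tendsto_natCast_atTop_atTop (R := ℝ))).congr' ?_
    filter_upwards [eventually_gt_atTop 0] with j hj
    field_simp
  have h4 : Tendsto N atTop (largeBlocklength Λ) := by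
    refine tendsto_inf.2 ⟨tendsto_comap_iff.2 h3, tendsto_comap_iff.2 (tendsto_pi_nhds.2 fun l => ?_)⟩
    have := (h1 l).div h2 one_ne_zero
    rw [div_one] at this
    refine this.congr' ?_
    filter_upwards [eventually_gt_atTop 0] with j hj
    have : (j : ℝ) ≠ 0 := by positivity
    simp only [Function.comp, Pi.div_apply]
    rw [div_div_div_cancel_right₀ this]
  exact h4.neBot

/-- The limiting expected degree profile `Λ^{(γ)}`. -/
def limitDegreeProfile (Λ P : ℝ[X]) (γ : ℝ) (l : ℕ) : ℝ :=
  limUnder (largeBlocklength Λ) fun N => expectedDegreeProfile Λ P γ N l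

end MultiPoisson

end

open MultiPoisson

/-! For fixed `γ` the number of rounds does not depend on the blocklength, so the proof has two
halves: a law of large numbers, one round at a time, as `n → ∞`, and an analysis of the limiting
recursion as `γ → 0`.

Within a round, the joint characteristic function of the draws is that of a compound Poisson
variable: the exponential of `∑ k, r_k ((1 + u) ^ k - 1)` with `u = ∑ i, w_i (ψ_i - 1)`. Since `∑ k,
k r_k = n γ`, it differs from `exp (n γ u)` by at most `n γ deg P ‖u‖ ^ 2`. If `ψ` differs from `1`
at one or two nodes only and the free sockets number at least `ε n`, then `u` is `O(1/n)`, and so is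
the error. The draws of a node are thus nearly Poisson with mean `γ * free / σ`, where `σ` is the
number of free sockets per node, and they are nearly independent for two distinct nodes. Fourier
inversion (`abs_mean_mul_sub_le`) transfers this to finitely supported test functions, and the
second moment method (`exists_mean_sq_le`, `eventually_mean_sq_le`) yields convergence to
`limitLaw`, in which a node of class `l` and degree `m` gains a Poisson number of edges with mean `γ
* free l m / σ_t`.

Under `limitLaw`, a round lowers the mean number `σ_t` of free sockets by `γ`, up to `γ ^ 2 L /
σ_t`, and raises the fraction of overfull nodes by at most `γ ^ 2 L / σ_t`; both errors come from
nodes drawn more than once in the round. Since `σ_t ≥ γ (T + 1 - t)`, with `T` the number of rounds,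
the errors add up to `O(√γ)` (`freeMean_bounds`). After the last round, the nodes whose degree is
not their class either have a free socket or are overfull, and both kinds have fraction `O(√γ)`.
Class and degree live on one probability space, so this bounds the total variation distance, with `b
= 1/2`. -/

namespace MultiPoisson

/-! ### Expectations of bounded functions under discrete laws -/

section Mean

variable {β β' : Type} {E : Type*} [NormedAddCommGroup E] [NormedSpace ℝ E]

/-- The expectation of a (bounded) Banach space valued function under a discrete law. -/
noncomputable def mean (p : PMF β) (f : β → E) : E := ∑' x, (p x).toReal • f x

lemma expect_eq_mean (p : PMF β) (f : β → ℝ) : expect p f = mean p f := rfl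

lemma summable_toReal (p : PMF β) : Summable fun x => (p x).toReal :=
  ENNReal.summable_toReal (by rw [p.tsum_coe]; exact ENNReal.one_ne_top)

lemma tsum_toReal (p : PMF β) : ∑' x, (p x).toReal = 1 := by
  rw [← ENNReal.tsum_toReal_eq fun x => p.apply_ne_top x, p.tsum_coe, ENNReal.toReal_one]

lemma norm_toReal_smul_le (p : PMF β) {f : β → E} {C : ℝ} (hf : ∀ x, ‖f x‖ ≤ C) (x : β) :
    ‖(p x).toReal • f x‖ ≤ (p x).toReal * C := by
  rw [norm_smul, Real.norm_of_nonneg ENNReal.toReal_nonneg]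
  exact mul_le_mul_of_nonneg_left (hf x) ENNReal.toReal_nonneg

lemma mean_const (p : PMF β) (c : E) : mean p (fun _ => c) = c := by
  rw [mean, (summable_toReal p).tsum_smul_const, tsum_toReal, one_smul]

lemma mean_congr (p : PMF β) {f g : β → E} (h : ∀ x ∈ p.support, f x = g x) :
    mean p f = mean p g := by
  refine tsum_congr fun x => ?_
  by_cases hx : x ∈ p.support
  · rw [h x hx]
  · rw [(p.apply_eq_zero_iff x).2 hx]; simp

lemma mean_pure (a : β) (f : β → E) : mean (PMF.pure a) f = f a := by
  rw [mean, tsum_eq_single a]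
  · simp
  · intro b hb
    simp [hb]

lemma norm_mean_le (p : PMF β) {f : β → E} {C : ℝ} (hf : ∀ x, ‖f x‖ ≤ C) : ‖mean p f‖ ≤ C := by
  have h := tsum_of_norm_bounded ((summable_toReal p).mul_right C).hasSum (norm_toReal_smul_le p hf)
  rwa [tsum_mul_right, tsum_toReal, one_mul] at h

lemma abs_mean_le (p : PMF β) {f : β → ℝ} {C : ℝ} (hf : ∀ x, |f x| ≤ C) : |mean p f| ≤ C :=
  norm_mean_le (E := ℝ) p (f := f) hf

variable [CompleteSpace E]

lemma summable_mean (p : PMF β) {f : β → E} {C : ℝ} (hf : ∀ x, ‖f x‖ ≤ C) :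
    Summable fun x => (p x).toReal • f x :=
  Summable.of_norm_bounded ((summable_toReal p).mul_right C) (norm_toReal_smul_le p hf)

lemma mean_add (p : PMF β) {f g : β → E} {C D : ℝ} (hf : ∀ x, ‖f x‖ ≤ C) (hg : ∀ x, ‖g x‖ ≤ D) :
    mean p (fun x => f x + g x) = mean p f + mean p g := by
  simp only [mean, smul_add]
  exact (summable_mean p hf).tsum_add (summable_mean p hg)

lemma mean_sub (p : PMF β) {f g : β → E} {C D : ℝ} (hf : ∀ x, ‖f x‖ ≤ C) (hg : ∀ x, ‖g x‖ ≤ D) :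
    mean p (fun x => f x - g x) = mean p f - mean p g := by
  simp only [mean, smul_sub]
  exact (summable_mean p hf).tsum_sub (summable_mean p hg)

lemma mean_const_mul {𝕜 : Type*} [RCLike 𝕜] (p : PMF β) (c : 𝕜) (f : β → 𝕜) :
    mean p (fun x => c * f x) = c * mean p f := by
  rw [mean, mean, ← tsum_mul_left]
  exact tsum_congr fun x => (mul_smul_comm _ _ _).symm

lemma mean_mul_const {𝕜 : Type*} [RCLike 𝕜] (p : PMF β) (c : 𝕜) (f : β → 𝕜) :
    mean p (fun x => f x * c) = mean p f * c := by
  simp only [mul_comm _ c, mean_const_mul]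

lemma mean_finsetSum {ι : Type*} (s : Finset ι) (p : PMF β) {f : ι → β → E} {C : ι → ℝ}
    (hf : ∀ i x, ‖f i x‖ ≤ C i) :
    mean p (fun x => ∑ i ∈ s, f i x) = ∑ i ∈ s, mean p (f i) := by
  simp only [mean, Finset.smul_sum]
  exact Summable.tsum_finsetSum fun i _ => summable_mean p (hf i)

lemma mean_mono (p : PMF β) {f g : β → ℝ} {C D : ℝ} (hf : ∀ x, ‖f x‖ ≤ C) (hg : ∀ x, ‖g x‖ ≤ D)
    (h : ∀ x ∈ p.support, f x ≤ g x) : mean p f ≤ mean p g := by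
  refine (summable_mean p hf).tsum_le_tsum (fun x => ?_) (summable_mean p hg)
  by_cases hx : x ∈ p.support
  · exact smul_le_smul_of_nonneg_left (h x hx) ENNReal.toReal_nonneg
  · rw [(p.apply_eq_zero_iff x).2 hx]; simp

lemma mean_nonneg (p : PMF β) {f : β → ℝ} (h : ∀ x, 0 ≤ f x) : 0 ≤ mean p f :=
  tsum_nonneg fun x => mul_nonneg ENNReal.toReal_nonneg (h x)

/-- Fubini: the joint weights are summable and `f` is bounded, so the double series converges
absolutely. -/
lemma mean_bind (p : PMF β) (q : β → PMF β') {f : β' → E} {C : ℝ} (hf : ∀ x, ‖f x‖ ≤ C) :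
    mean (p.bind q) f = mean p fun x => mean (q x) f := by
  have h1 : Summable fun z : β' × β => (p z.2 * q z.2 z.1).toReal := by
    apply ENNReal.summable_toReal
    rw [ENNReal.tsum_prod', ENNReal.tsum_comm]
    simp [ENNReal.tsum_mul_left]
  have h2 : Summable fun z : β' × β => (p z.2 * q z.2 z.1).toReal • f z.1 := by
    refine Summable.of_norm_bounded (h1.mul_right C) fun z => ?_
    rw [norm_smul, Real.norm_of_nonneg ENNReal.toReal_nonneg]
    exact mul_le_mul_of_nonneg_left (hf _) ENNReal.toReal_nonneg
  have h3 : ∀ y, ((p.bind q) y).toReal • f y = ∑' x, (p x * q x y).toReal • f y := by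
    intro y
    rw [(h1.prod_factor y).tsum_smul_const, PMF.bind_apply, ENNReal.tsum_toReal_eq]
    exact fun x => ENNReal.mul_ne_top (p.apply_ne_top x) ((q x).apply_ne_top y)
  simp only [mean, h3]
  rw [Summable.tsum_comm (f := fun x y => (p x * q x y).toReal • f y) h2.prod_symm]
  refine tsum_congr fun x => ?_
  simp only [ENNReal.toReal_mul, mul_smul]
  exact (summable_mean (q x) hf).tsum_const_smul _

lemma mean_map (p : PMF β) (g : β → β') {f : β' → E} {C : ℝ} (hf : ∀ x, ‖f x‖ ≤ C) :
    mean (p.map g) f = mean p fun x => f (g x) := by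
  rw [PMF.map, mean_bind p _ hf]
  simp only [Function.comp, mean_pure]

lemma ofReal_mean (p : PMF β) (f : β → ℝ) :
    ((mean p f : ℝ) : ℂ) = mean p fun x => (f x : ℂ) := by
  simp only [mean, Complex.ofReal_tsum]
  simp

end Mean

/-! ### Fourier inversion for integer-valued random variables -/

section Fourier

variable {β β' : Type}

lemma integral_exp_int_mul (a b : ℕ) :
    ∫ θ in (0 : ℝ)..2 * Real.pi, Complex.exp (θ * Complex.I) ^ b * Complex.exp (-(a * θ * Complex.I))
      = if b = a then ((2 * Real.pi : ℝ) : ℂ) else 0 := by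
  have h : ∀ θ : ℝ, Complex.exp (θ * Complex.I) ^ b * Complex.exp (-(a * θ * Complex.I))
      = Complex.exp ((((b : ℂ) - a) * Complex.I) * θ) := by
    intro θ
    rw [← Complex.exp_nat_mul, ← Complex.exp_add]
    ring_nf
  simp only [h]
  split_ifs with hab
  · simp [hab]
  · have hne : ((b : ℂ) - a) * Complex.I ≠ 0 :=
      mul_ne_zero (sub_ne_zero.2 (by exact_mod_cast hab)) Complex.I_ne_zero
    rw [integral_exp_mul_complex hne]
    have : ((b : ℂ) - a) * Complex.I * ((2 * Real.pi : ℝ) : ℂ)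
        = ((b - a : ℤ) : ℂ) * (2 * Real.pi * Complex.I) := by
      push_cast; ring
    rw [this, Complex.exp_int_mul_two_pi_mul_I]
    simp

lemma norm_exp_neg_mul_I (a : ℕ) (θ : ℝ) : ‖Complex.exp (-(a * θ * Complex.I))‖ = 1 := by
  have : -((a : ℂ) * θ * Complex.I) = ((-(a * θ) : ℝ) : ℂ) * Complex.I := by push_cast; ring
  rw [this, Complex.norm_exp_ofReal_mul_I]

/-- Termwise integration, dominated by the weights `p x`, and orthogonality of the exponentials. The
factor `g` is there so that inversion in one of two variables can carry the other along. -/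
lemma hasSum_fourier [Countable β] (p : PMF β) {g : β → ℂ} (hg : ∀ x, ‖g x‖ ≤ 1) (X : β → ℕ)
    (a : ℕ) :
    HasSum (fun x => (p x).toReal • (g x * if X x = a then ((2 * Real.pi : ℝ) : ℂ) else 0))
      (∫ θ in (0 : ℝ)..2 * Real.pi,
        mean p (fun x => g x * Complex.exp (θ * Complex.I) ^ X x) *
          Complex.exp (-(a * θ * Complex.I))) := by
  have key := intervalIntegral.hasSum_integral_of_dominated_convergence (a := 0)
    (b := 2 * Real.pi) (μ := MeasureTheory.volume)
    (F := fun x (θ : ℝ) => (p x).toReal • (g x * Complex.exp (θ * Complex.I) ^ X x) *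
      Complex.exp (-(a * θ * Complex.I)))
    (f := fun θ : ℝ => mean p (fun x => g x * Complex.exp (θ * Complex.I) ^ X x) *
          Complex.exp (-(a * θ * Complex.I)))
    (fun x _ => (p x).toReal) ?_ ?_ ?_ ?_ ?_
  · refine key.congr_fun fun x => ?_
    have : ∀ θ : ℝ, (p x).toReal • (g x * Complex.exp (θ * Complex.I) ^ X x) *
      Complex.exp (-(a * θ * Complex.I)) = ((p x).toReal * g x) *
        (Complex.exp (θ * Complex.I) ^ X x * Complex.exp (-(a * θ * Complex.I))) := by
      intro θ
      rw [Complex.real_smul]; ring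
    simp only [this]
    rw [intervalIntegral.integral_const_mul, integral_exp_int_mul, Complex.real_smul]
    ring
  · intro x
    apply Continuous.aestronglyMeasurable
    fun_prop
  · intro x
    refine MeasureTheory.ae_of_all _ fun θ _ => ?_
    rw [norm_mul, norm_exp_neg_mul_I, norm_smul, norm_mul, norm_pow, Complex.norm_exp_ofReal_mul_I,
      Real.norm_of_nonneg ENNReal.toReal_nonneg]
    simpa using mul_le_mul_of_nonneg_left (hg x) (ENNReal.toReal_nonneg (a := p x))
  · exact MeasureTheory.ae_of_all _ fun θ _ => summable_toReal p
  · simp only [tsum_toReal]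
    exact intervalIntegrable_const
  · refine MeasureTheory.ae_of_all _ fun θ _ => ?_
    have hs := summable_mean p (f := fun x => g x * Complex.exp (θ * Complex.I) ^ X x) (C := 1)
      fun x => by
        rw [norm_mul, norm_pow, Complex.norm_exp_ofReal_mul_I]
        simpa using hg x
    exact hs.hasSum.mul_right _

lemma continuous_mean_exp (p : PMF β) {g : β → ℂ} (hg : ∀ x, ‖g x‖ ≤ 1) (X : β → ℕ) :
    Continuous fun θ : ℝ => mean p (fun x => g x * Complex.exp (θ * Complex.I) ^ X x) := by
  unfold mean
  refine continuous_tsum (u := fun x => (p x).toReal) (fun x => ?_) (summable_toReal p)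
    fun x θ => ?_
  · fun_prop
  rw [norm_smul, norm_mul, norm_pow, Complex.norm_exp_ofReal_mul_I,
      Real.norm_of_nonneg ENNReal.toReal_nonneg]
  simpa using mul_le_mul_of_nonneg_left (hg x) (ENNReal.toReal_nonneg (a := p x))

/-- Closeness of characteristic functions implies closeness of point probabilities. -/
lemma norm_mean_indicator_sub_le [Countable β] [Countable β'] (p : PMF β) (q : PMF β')
    {g : β → ℂ} {h : β' → ℂ} (hg : ∀ x, ‖g x‖ ≤ 1) (hh : ∀ x, ‖h x‖ ≤ 1) (X : β → ℕ) (Y : β' → ℕ)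
    {C : ℝ}
    (hC : ∀ θ : ℝ, ‖mean p (fun x => g x * Complex.exp (θ * Complex.I) ^ X x) -
      mean q (fun x => h x * Complex.exp (θ * Complex.I) ^ Y x)‖ ≤ C) (a : ℕ) :
    ‖mean p (fun x => g x * if X x = a then 1 else 0) -
      mean q (fun x => h x * if Y x = a then 1 else 0)‖ ≤ C := by
  have e : ∀ {β : Type} [Countable β] (p : PMF β) {g : β → ℂ} (_ : ∀ x, ‖g x‖ ≤ 1) (X : β → ℕ),
      mean p (fun x => g x * if X x = a then 1 else 0) * ((2 * Real.pi : ℝ) : ℂ) =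
      ∫ θ in (0 : ℝ)..2 * Real.pi,
        mean p (fun x => g x * Complex.exp (θ * Complex.I) ^ X x) *
          Complex.exp (-(a * θ * Complex.I)) := by
    intro β _ p g hg X
    rw [← (hasSum_fourier p hg X a).tsum_eq, ← mean_mul_const, mean]
    refine tsum_congr fun x => ?_
    split_ifs <;> simp
  have hcont : ∀ {β : Type} (p : PMF β) {g : β → ℂ} (_ : ∀ x, ‖g x‖ ≤ 1) (X : β → ℕ),
      Continuous fun θ : ℝ => mean p (fun x => g x * Complex.exp (θ * Complex.I) ^ X x) *
          Complex.exp (-(a * θ * Complex.I)) := fun p _ hg X =>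
    (continuous_mean_exp p hg X).mul (by fun_prop)
  have hpos : (0 : ℝ) < 2 * Real.pi := by positivity
  have main : ‖(mean p (fun x => g x * if X x = a then 1 else 0) -
      mean q (fun x => h x * if Y x = a then 1 else 0)) * ((2 * Real.pi : ℝ) : ℂ)‖
      ≤ C * |2 * Real.pi - 0| := by
    rw [sub_mul, e p hg X, e q hh Y, ← intervalIntegral.integral_sub
      ((hcont p hg X).intervalIntegrable _ _) ((hcont q hh Y).intervalIntegrable _ _)]
    refine intervalIntegral.norm_integral_le_of_norm_le_const fun θ _ => ?_
    rw [← sub_mul, norm_mul, norm_exp_neg_mul_I, mul_one]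
    exact hC θ
  rw [norm_mul, Complex.norm_real, Real.norm_of_nonneg hpos.le, sub_zero, abs_of_pos hpos] at main
  exact le_of_mul_le_mul_right main hpos

/-- Closeness of joint characteristic functions implies closeness of expectations of products of
finitely supported functions. -/
lemma abs_mean_mul_sub_le [Countable β] [Countable β'] (p : PMF β) (q : PMF β')
    (X₁ X₂ : β → ℕ) (Y₁ Y₂ : β' → ℕ) {C : ℝ}
    (hC : ∀ θ φ : ℝ,
      ‖mean p (fun x => Complex.exp (θ * Complex.I) ^ X₁ x * Complex.exp (φ * Complex.I) ^ X₂ x) -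
        mean q (fun x => Complex.exp (θ * Complex.I) ^ Y₁ x * Complex.exp (φ * Complex.I) ^ Y₂ x)‖
        ≤ C) {B : ℕ} {M : ℝ} {f₁ f₂ : ℕ → ℝ} (h₁ : ∀ m, |f₁ m| ≤ M) (h₂ : ∀ m, |f₂ m| ≤ M)
    (z₁ : ∀ m, B ≤ m → f₁ m = 0) (z₂ : ∀ m, B ≤ m → f₂ m = 0) :
    |mean p (fun x => f₁ (X₁ x) * f₂ (X₂ x)) - mean q (fun x => f₁ (Y₁ x) * f₂ (Y₂ x))|
      ≤ B ^ 2 * M ^ 2 * C := by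
  have hM : 0 ≤ M := (abs_nonneg _).trans (h₁ 0)
  have hn : ∀ (θ : ℝ) (m : ℕ), ‖Complex.exp (θ * Complex.I) ^ m‖ ≤ 1 := fun θ m => by
    rw [norm_pow, Complex.norm_exp_ofReal_mul_I, one_pow]
  have hi : ∀ (m a : ℕ), ‖(if m = a then (1 : ℂ) else 0)‖ ≤ 1 := fun m a => by split_ifs <;> simp
  -- Inversion is done one variable at a time: in the second with the character of the first as
  -- weight, then in the first with the indicator of the second.
  have step1 : ∀ (θ : ℝ) (b : ℕ),
      ‖mean p (fun x => (if X₂ x = b then 1 else 0) * Complex.exp (θ * Complex.I) ^ X₁ x) -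
        mean q (fun x => (if Y₂ x = b then 1 else 0) * Complex.exp (θ * Complex.I) ^ Y₁ x)‖
        ≤ C := by
    intro θ b
    have := norm_mean_indicator_sub_le p q (fun x => hn θ (X₁ x)) (fun x => hn θ (Y₁ x)) X₂ Y₂
      (hC θ) b
    simpa only [mul_comm] using this
  have step2 : ∀ a b : ℕ,
      ‖mean p (fun x => (if X₂ x = b then 1 else 0) * (if X₁ x = a then (1 : ℂ) else 0)) -
        mean q (fun x => (if Y₂ x = b then 1 else 0) * (if Y₁ x = a then 1 else 0))‖ ≤ C :=
    fun a b => norm_mean_indicator_sub_le p q (fun x => hi (X₂ x) b) (fun x => hi (Y₂ x) b) X₁ Y₁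
      (fun θ => step1 θ b) a
  have expand : ∀ {f : ℕ → ℝ} (_ : ∀ m, B ≤ m → f m = 0) (m : ℕ),
      f m = ∑ a ∈ Finset.range B, f a * if m = a then 1 else 0 := by
    intro f z m
    by_cases hm : m < B
    · rw [Finset.sum_eq_single m] <;> aesop
    · rw [z m (not_lt.1 hm), Finset.sum_eq_zero]
      intro a ha
      rw [if_neg, mul_zero]
      rw [Finset.mem_range] at ha
      omega
  have e : ∀ {β : Type} (p : PMF β) (X₁ X₂ : β → ℕ),
      mean p (fun x => f₁ (X₁ x) * f₂ (X₂ x)) = ∑ a ∈ Finset.range B, ∑ b ∈ Finset.range B,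
        f₁ a * f₂ b * mean p (fun x =>
          (if X₂ x = b then 1 else 0) * (if X₁ x = a then (1 : ℝ) else 0)) := by
    intro β p X₁ X₂
    have h0 : ∀ (a b : ℕ) (x : β), ‖f₁ a * f₂ b * ((if X₂ x = b then 1 else 0) *
        (if X₁ x = a then (1 : ℝ) else 0))‖ ≤ |f₁ a * f₂ b| := by
      intro a b x
      split_ifs <;> simp <;> positivity
    simp only [← mean_const_mul]
    simp_rw [← mean_finsetSum (Finset.range B) p (h0 _)]
    rw [← mean_finsetSum (Finset.range B) p
      (C := fun a => ∑ b ∈ Finset.range B, |f₁ a * f₂ b|) fun a x =>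
        norm_sum_le_of_le _ fun b _ => h0 a b x]
    congr 1
    funext x
    rw [expand z₁ (X₁ x), expand z₂ (X₂ x), Finset.sum_mul_sum]
    refine Finset.sum_congr rfl fun a _ => Finset.sum_congr rfl fun b _ => ?_
    ring
  rw [e p, e q, ← Finset.sum_sub_distrib]
  have bd : ∀ a b : ℕ, |f₁ a * f₂ b * mean p (fun x =>
          (if X₂ x = b then 1 else 0) * (if X₁ x = a then (1 : ℝ) else 0)) -
        f₁ a * f₂ b * mean q (fun x =>
          (if Y₂ x = b then 1 else 0) * (if Y₁ x = a then (1 : ℝ) else 0))| ≤ M ^ 2 * C := by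
    intro a b
    rw [← mul_sub, abs_mul, abs_mul, sq]
    have h := step2 a b
    refine mul_le_mul (mul_le_mul (h₁ a) (h₂ b) (abs_nonneg _) hM) ?_ (abs_nonneg _)
      (mul_nonneg hM hM)
    rw [← Real.norm_eq_abs, ← Complex.norm_real, Complex.ofReal_sub, ofReal_mean, ofReal_mean]
    simpa only [Complex.ofReal_mul, apply_ite Complex.ofReal, Complex.ofReal_one,
      Complex.ofReal_zero] using h
  calc _ ≤ ∑ a ∈ Finset.range B, ∑ b ∈ Finset.range B, M ^ 2 * C := by
        refine (Finset.abs_sum_le_sum_abs _ _).trans (Finset.sum_le_sum fun a _ => ?_)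
        rw [← Finset.sum_sub_distrib]
        exact (Finset.abs_sum_le_sum_abs _ _).trans (Finset.sum_le_sum fun b _ => bd a b)
    _ = _ := by simp; ring

end Fourier

/-! ### The characteristic function of one round -/

section CharacteristicFunctions

lemma mean_indep : ∀ (m : ℕ) {β : Fin m → Type} (p : (i : Fin m) → PMF (β i))
    {F : (i : Fin m) → β i → ℂ} (_ : ∀ i x, ‖F i x‖ ≤ 1),
    mean (indep m p) (fun x => ∏ i, F i (x i)) = ∏ i, mean (p i) (F i)
  | 0, β, p, F, hF => by
    rw [indep, mean_pure]
    simp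
  | m + 1, β, p, F, hF => by
    have hb : ∀ x : (i : Fin (m + 1)) → β i, ‖∏ i, F i (x i)‖ ≤ 1 := fun x => by
      rw [norm_prod]
      exact Finset.prod_le_one (fun _ _ => norm_nonneg _) fun i _ => hF i _
    rw [indep, mean_bind _ _ hb]
    simp only [mean_map _ _ hb]
    simp only [Fin.prod_univ_succ, Fin.cons_zero, Fin.cons_succ, mean_const_mul]
    rw [mean_mul_const, mean_indep m (fun i => p i.succ) fun i => hF i.succ]

lemma norm_list_prod_le_one {β : Type} {g : β → ℂ} (hg : ∀ x, ‖g x‖ ≤ 1) (l : List β) :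
    ‖(l.map g).prod‖ ≤ 1 := by
  induction l with
  | nil => simp
  | cons a l ih =>
    rw [List.map_cons, List.prod_cons, norm_mul]
    exact mul_le_one₀ (hg a) (norm_nonneg _) ih

lemma mean_iidList {β : Type} (p : PMF β) {g : β → ℂ} (hg : ∀ x, ‖g x‖ ≤ 1) (m : ℕ) :
    mean (iidList p m) (fun l => (l.map g).prod) = mean p g ^ m := by
  induction m with
  | zero => rw [iidList, mean_pure]; simp
  | succ m ih =>
    rw [iidList, mean_bind _ _ (norm_list_prod_le_one hg)]
    simp only [mean_map _ _ (norm_list_prod_le_one hg), List.map_cons, List.prod_cons,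
      mean_const_mul, ih]
    rw [mean_mul_const, pow_succ']

lemma poissonPMF_apply_toReal (r : ℝ≥0) (m : ℕ) :
    ((poissonMeasure r).toPMF m).toReal = Real.exp (-r) * r ^ m / m.factorial := by
  rw [MeasureTheory.Measure.toPMF_apply, ← MeasureTheory.measureReal_def,
    poissonMeasure_real_singleton]

lemma mean_poisson_pow (r : ℝ≥0) (z : ℂ) :
    mean (poissonMeasure r).toPMF (fun m => z ^ m) = Complex.exp (r * (z - 1)) := by
  have h := (NormedSpace.expSeries_div_hasSum_exp ((r : ℂ) * z)).mul_left (Complex.exp (-r))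
  rw [← Complex.exp_eq_exp_ℂ, ← Complex.exp_add] at h
  rw [mean, show (r : ℂ) * (z - 1) = -r + r * z by ring, ← h.tsum_eq]
  refine tsum_congr fun m => ?_
  rw [poissonPMF_apply_toReal, Complex.real_smul]
  push_cast
  rw [mul_pow]
  ring

/-- The probability that a socket is matched to the variable node `i`. -/
noncomputable def weight {n : ℕ} (d : Fin n → ℤ) (i : Fin n) : ℝ :=
  ((d i).toNat : ℝ) / ∑ j, ((d j).toNat : ℝ)

lemma weight_nonneg {n : ℕ} (d : Fin n → ℤ) (i : Fin n) : 0 ≤ weight d i :=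
  div_nonneg (Nat.cast_nonneg _) (Finset.sum_nonneg fun _ _ => Nat.cast_nonneg _)

lemma sum_toNat_pos {n : ℕ} {d : Fin n → ℤ} (h : ∃ i, 0 < d i) : 0 < ∑ j, ((d j).toNat : ℝ) := by
  obtain ⟨i, hi⟩ := h
  refine Finset.sum_pos' (fun _ _ => Nat.cast_nonneg _) ⟨i, Finset.mem_univ i, ?_⟩
  have : 0 < (d i).toNat := by omega
  exact_mod_cast this

lemma sum_weight {n : ℕ} {d : Fin n → ℤ} (h : ∃ i, 0 < d i) : ∑ i, weight d i = 1 := by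
  simp only [weight, ← Finset.sum_div]
  exact div_self (sum_toNat_pos h).ne'

lemma mean_biased {n : ℕ} (d : Fin n → ℤ) (h : ∃ i, 0 < d i) (ψ : Fin n → ℂ) :
    mean (biased d h) ψ = ∑ i, (weight d i : ℂ) * ψ i := by
  rw [mean, tsum_fintype]
  refine Finset.sum_congr rfl fun i _ => ?_
  rw [Complex.real_smul, biased, PMF.normalize_apply, tsum_fintype, ENNReal.toReal_mul,
    ENNReal.toReal_inv, ENNReal.toReal_sum fun _ _ => ENNReal.natCast_ne_top _, weight]
  simp [div_eq_mul_inv]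

lemma prod_pow_card_fiber {n k : ℕ} (ψ : Fin n → ℂ) (a : Fin k → Fin n) :
    ∏ i, ψ i ^ (Finset.univ.filter fun r => a r = i).card = ∏ r, ψ (a r) := by
  rw [← Finset.prod_fiberwise Finset.univ a]
  refine Finset.prod_congr rfl fun i _ => ?_
  rw [Finset.prod_congr rfl (g := fun _ => ψ i), Finset.prod_const]
  intro r hr
  rw [(Finset.mem_filter.1 hr).2]

/-- Regrouping by check nodes instead of variable nodes exposes the independent factors. -/
lemma prod_pow_count {n K : ℕ} (ψ : Fin n → ℂ) (R : Round n K) :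
    ∏ i, ψ i ^ R.count i = ∏ k : Fin (K + 1), ((R k).map fun a => ∏ r, ψ (a r)).prod := by
  simp only [Round.count, ← Finset.prod_pow_eq_pow_sum]
  rw [Finset.prod_comm]
  refine Finset.prod_congr rfl fun k _ => ?_
  induction R k with
  | nil => simp
  | cons a l ih =>
    simp only [List.map_cons, List.sum_cons, pow_add, Finset.prod_mul_distrib, ih, List.prod_cons,
      prod_pow_card_fiber]

lemma mean_roundLaw (n : ℕ) (P : ℝ[X]) (γ : ℝ) {d : Fin n → ℤ} (h : ∃ i, 0 < d i) {ψ : Fin n → ℂ}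
    (hψ : ∀ i, ‖ψ i‖ ≤ 1) :
    mean (roundLaw n P γ d) (fun R => ∏ i, ψ i ^ R.count i) =
      Complex.exp (∑ k ∈ Finset.range (P.natDegree + 1),
        ((n * γ * P.coeff k / P.derivative.eval 1).toNNReal : ℂ) *
          ((∑ i, (weight d i : ℂ) * ψ i) ^ k - 1)) := by
  have hprod : ∀ {k : ℕ} (a : Fin k → Fin n), ‖∏ r, ψ (a r)‖ ≤ 1 := fun a => by
    rw [norm_prod]
    exact Finset.prod_le_one (fun _ _ => norm_nonneg _) fun i _ => hψ _
  simp only [prod_pow_count]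
  rw [roundLaw, dif_pos h, mean_indep _ _
    (F := fun k (l : List (Fin k → Fin n)) => (l.map fun a => ∏ r, ψ (a r)).prod)
    fun k l => norm_list_prod_le_one hprod l]
  rw [Complex.exp_sum, ← Fin.prod_univ_eq_prod_range (fun k =>
    Complex.exp (((n * γ * P.coeff k / P.derivative.eval 1).toNNReal : ℂ) *
          ((∑ i, (weight d i : ℂ) * ψ i) ^ k - 1)))]
  refine Finset.prod_congr rfl fun k _ => ?_
  rw [mean_bind _ _ (norm_list_prod_le_one hprod)]
  simp only [mean_iidList _ hprod]
  have : mean (indep k fun _ : Fin k => biased d h) (fun a => ∏ r, ψ (a r)) =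
      (∑ i, (weight d i : ℂ) * ψ i) ^ (k : ℕ) := by
    rw [mean_indep k (fun _ => biased d h) fun _ => hψ]
    simp [mean_biased]
  rw [this, mean_poisson_pow]

/-- Mean value inequality: the left half-plane is convex and `exp` has derivative of norm at most
`1` there. -/
lemma norm_exp_sub_exp_le {a b : ℂ} (ha : a.re ≤ 0) (hb : b.re ≤ 0) :
    ‖Complex.exp a - Complex.exp b‖ ≤ ‖a - b‖ := by
  have h := Convex.norm_image_sub_le_of_norm_deriv_le (f := Complex.exp) (C := 1)
    (s := {z : ℂ | z.re ≤ 0}) (x := b) (y := a) (fun x _ => Complex.differentiableAt_exp)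
    (fun x hx => ?_) (convex_halfSpace_re_le 0) hb ha
  · simpa using h
  · rw [Complex.deriv_exp, Complex.norm_exp]
    exact Real.exp_le_one_iff.2 hx

/-- Second-order Taylor remainder. Smallness of `u` is not needed, because `‖1 + u‖ ≤ 1` keeps the
error from growing under multiplication by `1 + u`. -/
lemma norm_one_add_pow_sub_le {u : ℂ} (hu : ‖1 + u‖ ≤ 1) (k : ℕ) :
    ‖(1 + u) ^ k - 1 - k * u‖ ≤ k ^ 2 * ‖u‖ ^ 2 := by
  induction k with
  | zero => simp
  | succ k ih =>
    have e : (1 + u) ^ (k + 1) - 1 - ((k + 1 : ℕ) : ℂ) * u =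
        ((1 + u) ^ k - 1 - k * u) * (1 + u) + k * u ^ 2 := by
      push_cast; ring
    rw [e]
    refine (norm_add_le _ _).trans ?_
    rw [norm_mul, norm_mul, norm_pow, Complex.norm_natCast]
    have h1 := mul_le_of_le_one_right (norm_nonneg ((1 + u) ^ k - 1 - k * u)) hu
    push_cast
    nlinarith [sq_nonneg ‖u‖, (Nat.cast_nonneg k : (0 : ℝ) ≤ k)]

lemma derivative_eval_one (P : ℝ[X]) :
    P.derivative.eval 1 = ∑ k ∈ Finset.range (P.natDegree + 1), (k : ℝ) * P.coeff k := by
  rw [Polynomial.derivative_eval, Polynomial.sum_over_range _ (by simp)]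
  simp [mul_comm]

lemma IsDegreeSequence.sum_coeff {Q : ℝ[X]} (hQ : IsDegreeSequence Q) :
    ∑ k ∈ Finset.range (Q.natDegree + 1), Q.coeff k = 1 := by
  rw [← hQ.eval_one, Polynomial.eval_eq_sum_range]
  simp

lemma IsDegreeSequence.two_le_derivative {Q : ℝ[X]} (hQ : IsDegreeSequence Q) :
    2 ≤ Q.derivative.eval 1 := by
  rw [derivative_eval_one, ← mul_one 2, ← hQ.sum_coeff, Finset.mul_sum]
  refine Finset.sum_le_sum fun k _ => ?_
  rcases k with _ | _ | k
  · simp [hQ.coeff_zero]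
  · simp [hQ.coeff_one]
  · refine mul_le_mul_of_nonneg_right ?_ (hQ.nonneg _)
    push_cast
    linarith [(Nat.cast_nonneg k : (0 : ℝ) ≤ k)]

/-- The normalisation by `P'(1)` makes the rates times `k` sum to `μ`, which gives the linear term.
In the remainder `k ^ 2 ≤ k * P.natDegree`, so the same identity applies. -/
lemma norm_exponent_sub_le {P : ℝ[X]} (hP : IsDegreeSequence P) {μ : ℝ} (hμ : 0 ≤ μ) {u : ℂ}
    (hu : ‖1 + u‖ ≤ 1) :
    ‖(∑ k ∈ Finset.range (P.natDegree + 1),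
        ((μ * P.coeff k / P.derivative.eval 1).toNNReal : ℂ) * ((1 + u) ^ k - 1)) - μ * u‖ ≤
      μ * P.natDegree * ‖u‖ ^ 2 := by
  have hD : 0 < P.derivative.eval 1 := by linarith [hP.two_le_derivative]
  have hc : ∀ k, ((μ * P.coeff k / P.derivative.eval 1).toNNReal : ℝ) =
      μ * P.coeff k / P.derivative.eval 1 := fun k =>
    Real.coe_toNNReal _ (div_nonneg (mul_nonneg hμ (hP.nonneg k)) hD.le)
  have hc' : ∀ k, (((μ * P.coeff k / P.derivative.eval 1).toNNReal : ℝ≥0) : ℂ) =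
      ((μ * P.coeff k / P.derivative.eval 1 : ℝ) : ℂ) := fun k =>
    congrArg Complex.ofReal (hc k)
  have hs : (μ : ℂ) * u = ∑ k ∈ Finset.range (P.natDegree + 1),
      ((μ * P.coeff k / P.derivative.eval 1 : ℝ) : ℂ) * (k * u) := by
    have : (μ : ℝ) = ∑ k ∈ Finset.range (P.natDegree + 1),
        (μ * P.coeff k / P.derivative.eval 1) * k := by
      have e := derivative_eval_one P
      calc μ = μ * (P.derivative.eval 1) / P.derivative.eval 1 := by field_simp
        _ = _ := by
          conv_lhs => rw [e, Finset.mul_sum, Finset.sum_div]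
          exact Finset.sum_congr rfl fun k _ => by rw [e]; ring
    conv_lhs => rw [this]
    push_cast
    rw [Finset.sum_mul]
    exact Finset.sum_congr rfl fun k _ => by ring
  rw [hs, ← Finset.sum_sub_distrib]
  have hr : μ * P.natDegree * ‖u‖ ^ 2 = ∑ k ∈ Finset.range (P.natDegree + 1),
      (μ * P.coeff k / P.derivative.eval 1) * (k * P.natDegree * ‖u‖ ^ 2) := by
    have e := derivative_eval_one P
    calc μ * P.natDegree * ‖u‖ ^ 2
        = μ * P.natDegree * ‖u‖ ^ 2 * (P.derivative.eval 1) / P.derivative.eval 1 := by field_simp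
      _ = _ := by
          conv_lhs => rw [e, Finset.mul_sum, Finset.sum_div]
          exact Finset.sum_congr rfl fun k _ => by rw [e]; ring
  rw [hr]
  refine norm_sum_le_of_le _ fun k hk => ?_
  have hk' : (k : ℝ) ≤ P.natDegree := by
    exact_mod_cast Nat.lt_succ_iff.1 (Finset.mem_range.1 hk)
  have hnn : 0 ≤ μ * P.coeff k / P.derivative.eval 1 :=
    div_nonneg (mul_nonneg hμ (hP.nonneg k)) hD.le
  rw [hc', ← mul_sub, norm_mul, Complex.norm_real, Real.norm_of_nonneg hnn]
  refine mul_le_mul_of_nonneg_left ((norm_one_add_pow_sub_le hu k).trans ?_) hnn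
  rw [sq (k : ℝ)]
  gcongr

end CharacteristicFunctions

/-! ### Poisson approximation of the draws in one round -/

section Comparison

/-- The Poisson law with mean `r`. -/
noncomputable def pois (r : ℝ) : PMF ℕ := (poissonMeasure r.toNNReal).toPMF

lemma mean_pois_pow {r : ℝ} (hr : 0 ≤ r) (z : ℂ) :
    mean (pois r) (fun m => z ^ m) = Complex.exp (r * (z - 1)) := by
  rw [pois, mean_poisson_pow]
  have : ((r.toNNReal : ℝ≥0) : ℂ) = (r : ℂ) := congrArg Complex.ofReal (Real.coe_toNNReal r hr)
  rw [this]

/-- The two-variable estimate with second variable constantly `0`, tested against the indicator of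
`0`; this is where `1 ≤ B` and `1 ≤ M` enter. -/
lemma abs_mean_sub_le {β β' : Type} [Countable β] [Countable β'] (p : PMF β) (q : PMF β')
    (X : β → ℕ) (Y : β' → ℕ) {C : ℝ}
    (hC : ∀ θ : ℝ, ‖mean p (fun x => Complex.exp (θ * Complex.I) ^ X x) -
        mean q (fun x => Complex.exp (θ * Complex.I) ^ Y x)‖ ≤ C)
    {B : ℕ} {M : ℝ} (hB : 1 ≤ B) (hM : 1 ≤ M) {f : ℕ → ℝ} (h : ∀ m, |f m| ≤ M)
    (z : ∀ m, B ≤ m → f m = 0) :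
    |mean p (fun x => f (X x)) - mean q (fun x => f (Y x))| ≤ B ^ 2 * M ^ 2 * C := by
  have := abs_mean_mul_sub_le p q X (fun _ => 0) Y (fun _ => 0) (C := C)
    (fun θ φ => by simpa using hC θ) h (f₂ := fun m => if m = 0 then 1 else 0)
    (fun m => by split_ifs <;> simp <;> linarith) z (fun m hm => if_neg (by omega))
  simpa using this

lemma abs_mean_pois_sub_le {r s : ℝ} (hr : 0 ≤ r) (hs : 0 ≤ s)
    {B : ℕ} {M : ℝ} (hB : 1 ≤ B) (hM : 1 ≤ M) {f : ℕ → ℝ} (h : ∀ m, |f m| ≤ M)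
    (z : ∀ m, B ≤ m → f m = 0) :
    |mean (pois r) f - mean (pois s) f| ≤ B ^ 2 * M ^ 2 * (2 * |r - s|) := by
  refine abs_mean_sub_le (pois r) (pois s) (fun m => m) (fun m => m) (fun θ => ?_) hB hM h z
  have hn : ‖Complex.exp (θ * Complex.I)‖ = 1 := Complex.norm_exp_ofReal_mul_I θ
  have hre : (Complex.exp (θ * Complex.I) - 1).re ≤ 0 := by
    have := (Complex.re_le_norm (Complex.exp (θ * Complex.I))).trans_eq hn
    simpa using this
  have hre' : ∀ {r : ℝ}, 0 ≤ r → ((r : ℂ) * (Complex.exp (θ * Complex.I) - 1)).re ≤ 0 := by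
    intro r hr
    rw [Complex.re_ofReal_mul]
    exact mul_nonpos_of_nonneg_of_nonpos hr hre
  rw [mean_pois_pow hr, mean_pois_pow hs]
  refine (norm_exp_sub_exp_le (hre' hr) (hre' hs)).trans ?_
  rw [← sub_mul, norm_mul, ← Complex.ofReal_sub, Complex.norm_real, mul_comm, Real.norm_eq_abs]
  refine mul_le_mul_of_nonneg_right ((norm_sub_le _ _).trans ?_) (abs_nonneg _)
  rw [hn, norm_one]
  norm_num

lemma sum_weight_mul {n : ℕ} {d : Fin n → ℤ} (h : ∃ i, 0 < d i) (ψ : Fin n → ℂ) :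
    ∑ i, (weight d i : ℂ) * ψ i = 1 + ∑ i, (weight d i : ℂ) * (ψ i - 1) := by
  have : ∑ i, (weight d i : ℂ) = 1 := by exact_mod_cast sum_weight h
  simp only [mul_sub, mul_one, Finset.sum_sub_distrib, this]
  ring

lemma norm_sum_weight_mul_le_one {n : ℕ} {d : Fin n → ℤ} (h : ∃ i, 0 < d i) {ψ : Fin n → ℂ}
    (hψ : ∀ i, ‖ψ i‖ ≤ 1) : ‖∑ i, (weight d i : ℂ) * ψ i‖ ≤ 1 := by
  rw [← sum_weight h]
  refine norm_sum_le_of_le _ fun i _ => ?_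
  rw [norm_mul, Complex.norm_real, Real.norm_of_nonneg (weight_nonneg d i)]
  exact mul_le_of_le_one_right (weight_nonneg d i) (hψ i)

lemma norm_mean_roundLaw_sub_le (n : ℕ) {P : ℝ[X]} (hP : IsDegreeSequence P) {γ : ℝ} (hγ : 0 ≤ γ)
    {d : Fin n → ℤ} (h : ∃ i, 0 < d i) {ψ : Fin n → ℂ} (hψ : ∀ i, ‖ψ i‖ ≤ 1) :
    ‖mean (roundLaw n P γ d) (fun R => ∏ i, ψ i ^ R.count i) -
        Complex.exp ((n * γ : ℝ) * ∑ i, (weight d i : ℂ) * (ψ i - 1))‖ ≤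
      n * γ * P.natDegree * ‖∑ i, (weight d i : ℂ) * (ψ i - 1)‖ ^ 2 := by
  have h1 := norm_sum_weight_mul_le_one h hψ
  rw [mean_roundLaw n P γ h hψ]
  rw [sum_weight_mul h ψ] at h1 ⊢
  have hμ : 0 ≤ n * γ := mul_nonneg (Nat.cast_nonneg n) hγ
  refine (norm_exp_sub_exp_le ?_ ?_).trans (norm_exponent_sub_le hP hμ h1)
  · rw [Complex.re_sum]
    refine Finset.sum_nonpos fun k _ => ?_
    have e : ∀ (r : ℝ≥0) (z : ℂ), ((r : ℂ) * z).re = r * z.re := fun r z =>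
      Complex.re_ofReal_mul r z
    rw [e]
    refine mul_nonpos_of_nonneg_of_nonpos (NNReal.coe_nonneg _) ?_
    have := (Complex.re_le_norm ((1 + ∑ i, (weight d i : ℂ) * (ψ i - 1)) ^ k)).trans
      ((norm_pow _ k).trans_le (pow_le_one₀ (norm_nonneg _) h1))
    simpa using this
  · rw [Complex.re_ofReal_mul]
    refine mul_nonpos_of_nonneg_of_nonpos hμ ?_
    have := (Complex.re_le_norm _).trans h1
    simpa using this

lemma norm_exp_sub_one_le_two (θ : ℝ) : ‖Complex.exp (θ * Complex.I) - 1‖ ≤ 2 := by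
  refine (norm_sub_le _ _).trans ?_
  rw [Complex.norm_exp_ofReal_mul_I, norm_one]
  norm_num

/-- The number of draws of a variable node is almost Poisson distributed. -/
lemma abs_mean_count_sub_le (n : ℕ) {P : ℝ[X]} (hP : IsDegreeSequence P) {γ : ℝ} (hγ : 0 ≤ γ)
    {d : Fin n → ℤ} (h : ∃ i, 0 < d i) (i : Fin n) {w : ℝ} (hw : ∀ i, weight d i ≤ w)
    {B : ℕ} {M : ℝ} (hB : 1 ≤ B) (hM : 1 ≤ M) {f : ℕ → ℝ} (hf : ∀ m, |f m| ≤ M)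
    (z : ∀ m, B ≤ m → f m = 0) :
    |mean (roundLaw n P γ d) (fun R => f (R.count i)) - mean (pois (n * γ * weight d i)) f| ≤
      B ^ 2 * M ^ 2 * (n * γ * P.natDegree * (4 * w) ^ 2) := by
  have hμ : 0 ≤ n * γ := mul_nonneg (Nat.cast_nonneg n) hγ
  refine abs_mean_sub_le (roundLaw n P γ d) (pois (n * γ * weight d i)) (fun R => R.count i)
    (fun m => m) (fun θ => ?_) hB hM hf z
  -- This test vector isolates the draws of `i`, and leaves a single term in `∑ v, w_v (ψ_v - 1)`.
  let ψ : Fin n → ℂ := fun v => if v = i then Complex.exp (θ * Complex.I) else 1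
  have hψ : ∀ v, ‖ψ v‖ ≤ 1 := fun v => by
    simp only [ψ]
    split_ifs <;> simp
  have e1 : ∀ R : Round n P.natDegree,
      Complex.exp (θ * Complex.I) ^ R.count i = ∏ v, ψ v ^ R.count v := fun R => by
    rw [Finset.prod_eq_single i] <;> simp +contextual [ψ]
  have e2 : ∑ v, (weight d v : ℂ) * (ψ v - 1) =
      weight d i * (Complex.exp (θ * Complex.I) - 1) := by
    rw [Finset.sum_eq_single i] <;> simp +contextual [ψ]
  simp only [e1]
  rw [mean_pois_pow (mul_nonneg hμ (weight_nonneg d i)), Complex.ofReal_mul, mul_assoc, ← e2]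
  refine (norm_mean_roundLaw_sub_le n hP hγ h hψ).trans ?_
  refine mul_le_mul_of_nonneg_left (pow_le_pow_left₀ (norm_nonneg _) ?_ 2)
    (mul_nonneg hμ (Nat.cast_nonneg _))
  rw [e2, norm_mul, Complex.norm_real, Real.norm_of_nonneg (weight_nonneg d i)]
  -- One node contributes only `2 * w`; the weaker `4 * w` gives the same error term as for two
  -- nodes.
  nlinarith [hw i, weight_nonneg d i, norm_exp_sub_one_le_two θ,
    norm_nonneg (Complex.exp (θ * Complex.I) - 1)]

/-- The numbers of draws of two variable nodes are almost independent. -/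
lemma abs_mean_count_mul_sub_le (n : ℕ) {P : ℝ[X]} (hP : IsDegreeSequence P) {γ : ℝ} (hγ : 0 ≤ γ)
    {d : Fin n → ℤ} (h : ∃ i, 0 < d i) {i j : Fin n} (hij : i ≠ j) {w : ℝ}
    (hw : ∀ i, weight d i ≤ w) {B : ℕ} {M : ℝ} {f₁ f₂ : ℕ → ℝ} (h₁ : ∀ m, |f₁ m| ≤ M)
    (h₂ : ∀ m, |f₂ m| ≤ M) (z₁ : ∀ m, B ≤ m → f₁ m = 0) (z₂ : ∀ m, B ≤ m → f₂ m = 0) :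
    |mean (roundLaw n P γ d) (fun R => f₁ (R.count i) * f₂ (R.count j)) -
        mean (pois (n * γ * weight d i)) f₁ * mean (pois (n * γ * weight d j)) f₂| ≤
      B ^ 2 * M ^ 2 * (n * γ * P.natDegree * (4 * w) ^ 2) := by
  have hμ : 0 ≤ n * γ := mul_nonneg (Nat.cast_nonneg n) hγ
  -- The product of the two Poisson laws, as a single law to compare characteristic functions with.
  let q : PMF (ℕ × ℕ) := (pois (n * γ * weight d i)).bind fun a =>
    (pois (n * γ * weight d j)).map fun b => (a, b)
  have hq : ∀ {𝕜 : Type} [RCLike 𝕜] {g₁ g₂ : ℕ → 𝕜} {C : ℝ},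
      (∀ x : ℕ × ℕ, ‖g₁ x.1 * g₂ x.2‖ ≤ C) → mean q (fun x => g₁ x.1 * g₂ x.2) =
      mean (pois (n * γ * weight d i)) g₁ * mean (pois (n * γ * weight d j)) g₂ := by
    intro 𝕜 _ g₁ g₂ C hg
    rw [mean_bind _ _ hg]
    simp only [mean_map _ _ hg]
    simp only [mean_const_mul, mean_mul_const]
  have hb : ∀ x : ℕ × ℕ, ‖f₁ x.1 * f₂ x.2‖ ≤ M * M := fun x => by
    rw [norm_mul]
    exact mul_le_mul (h₁ _) (h₂ _) (norm_nonneg _) ((abs_nonneg _).trans (h₁ 0))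
  rw [← hq hb]
  refine abs_mean_mul_sub_le (roundLaw n P γ d) q (fun R => R.count i) (fun R => R.count j)
    Prod.fst Prod.snd (fun θ φ => ?_) h₁ h₂ z₁ z₂
  let ψ : Fin n → ℂ := fun v => (if v = i then Complex.exp (θ * Complex.I) else 1) *
    (if v = j then Complex.exp (φ * Complex.I) else 1)
  have hψ : ∀ v, ‖ψ v‖ ≤ 1 := fun v => by
    simp only [ψ]
    split_ifs <;> simp
  have e1 : ∀ R : Round n P.natDegree, Complex.exp (θ * Complex.I) ^ R.count i *
      Complex.exp (φ * Complex.I) ^ R.count j = ∏ v, ψ v ^ R.count v := fun R => by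
    simp only [ψ, mul_pow, Finset.prod_mul_distrib]
    congr 1
    · rw [Finset.prod_eq_single i] <;> simp +contextual
    · rw [Finset.prod_eq_single j] <;> simp +contextual
  have e2 : ∑ v, (weight d v : ℂ) * (ψ v - 1) =
      weight d i * (Complex.exp (θ * Complex.I) - 1) +
      weight d j * (Complex.exp (φ * Complex.I) - 1) := by
    have : ∀ v, (weight d v : ℂ) * (ψ v - 1) =
        (if v = i then weight d i * (Complex.exp (θ * Complex.I) - 1) else 0) +
        (if v = j then weight d j * (Complex.exp (φ * Complex.I) - 1) else 0) := by
      intro v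
      by_cases hi : v = i
      · subst hi; simp [ψ, hij]
      · by_cases hj : v = j
        · subst hj; simp [ψ, hi]
        · simp [ψ, hi, hj]
    simp only [this, Finset.sum_add_distrib, Finset.sum_ite_eq', Finset.mem_univ, if_true]
  have e3 : mean q (fun x => Complex.exp (θ * Complex.I) ^ x.1 * Complex.exp (φ * Complex.I) ^ x.2)
      = Complex.exp ((n * γ : ℝ) * ∑ v, (weight d v : ℂ) * (ψ v - 1)) := by
    rw [hq (g₁ := fun m => Complex.exp (θ * Complex.I) ^ m)
      (g₂ := fun m => Complex.exp (φ * Complex.I) ^ m) (C := 1) fun x => by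
        simp only [norm_mul, norm_pow, Complex.norm_exp_ofReal_mul_I]; simp,
      mean_pois_pow (mul_nonneg hμ (weight_nonneg d i)),
      mean_pois_pow (mul_nonneg hμ (weight_nonneg d j)), ← Complex.exp_add, e2]
    push_cast
    ring_nf
  simp only [e1, e3]
  refine (norm_mean_roundLaw_sub_le n hP hγ h hψ).trans ?_
  refine mul_le_mul_of_nonneg_left (pow_le_pow_left₀ (norm_nonneg _) ?_ 2)
    (mul_nonneg hμ (Nat.cast_nonneg _))
  rw [e2]
  refine (norm_add_le _ _).trans ?_
  rw [norm_mul, norm_mul, Complex.norm_real, Complex.norm_real,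
    Real.norm_of_nonneg (weight_nonneg d i), Real.norm_of_nonneg (weight_nonneg d j)]
  have hi := mul_le_mul (hw i) (norm_exp_sub_one_le_two θ) (norm_nonneg _)
    ((weight_nonneg d i).trans (hw i))
  have hj := mul_le_mul (hw j) (norm_exp_sub_one_le_two φ) (norm_nonneg _)
    ((weight_nonneg d i).trans (hw i))
  linarith

end Comparison

/-! ### Second moments -/

section Moments

variable {β : Type} (p : PMF β) {h : β → ℝ} {M : ℝ} (hM : ∀ x, |h x| ≤ M)

include hM in
lemma mean_sub_sq (y : ℝ) :
    mean p (fun x => (h x - y) ^ 2) = mean p (fun x => h x ^ 2) - 2 * y * mean p h + y ^ 2 := by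
  have e0 : ∀ x, (h x - y) ^ 2 = h x ^ 2 - 2 * y * h x + y ^ 2 := fun x => by ring
  have b1 : ∀ x, ‖h x ^ 2‖ ≤ M ^ 2 := fun x => by
    rw [norm_pow]
    exact pow_le_pow_left₀ (norm_nonneg _) (hM x) 2
  have b2 : ∀ x, ‖2 * y * h x‖ ≤ ‖2 * y‖ * M := fun x => by
    rw [norm_mul]
    exact mul_le_mul_of_nonneg_left (hM x) (norm_nonneg _)
  simp only [e0]
  rw [mean_add (f := fun x => h x ^ 2 - 2 * y * h x) (g := fun _ => y ^ 2) p
      (fun R => norm_sub_le_of_le (b1 R) (b2 R)) (fun R => le_rfl),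
    mean_sub p b1 b2, mean_const, mean_const_mul]

include hM in
lemma sq_mean_le : mean p h ^ 2 ≤ mean p fun x => h x ^ 2 := by
  have := mean_sub_sq p hM (mean p h) ▸ mean_nonneg p fun x => sq_nonneg (h x - mean p h)
  linarith [sq (mean p h)]

lemma abs_mean_le_of_support {f : β → ℝ} {C : ℝ} (hC : 0 ≤ C) (hf : ∀ x ∈ p.support, |f x| ≤ C) :
    |mean p f| ≤ C := by
  classical
  rw [mean_congr p (g := fun x => if x ∈ p.support then f x else 0) fun x hx => (if_pos hx).symm]
  refine abs_mean_le p fun x => ?_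
  split_ifs with hx
  · exact hf x hx
  · simpa using hC

end Moments

/-! ### Mean and fluctuation of empirical averages over one round -/

section OneRound

variable {L : ℕ}

/-- The average of `f (class of i) (degree of i)` over the variable nodes `i`. -/
noncomputable def empirical {n : ℕ} (c : Fin n → Fin (L + 1)) (m : Fin n → ℕ)
    (f : Fin (L + 1) → ℕ → ℝ) : ℝ :=
  (∑ i, f (c i) (m i)) / n

/-- The number of free sockets of a node of class `l` and degree `m`. -/
def free (l : Fin (L + 1)) (m : ℕ) : ℝ := ((l - m : ℕ) : ℝ)

/-- The limiting transition operator of one round, at `σ` free sockets per variable node. -/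
noncomputable def transition (γ σ : ℝ) (f : Fin (L + 1) → ℕ → ℝ) (l : Fin (L + 1)) (m : ℕ) : ℝ :=
  mean (pois (γ * free l m / σ)) fun a => f l (m + a)

lemma free_nonneg (l : Fin (L + 1)) (m : ℕ) : 0 ≤ free l m := Nat.cast_nonneg _

lemma free_le (l : Fin (L + 1)) (m : ℕ) : free l m ≤ L := by
  have : (l - m : ℕ) ≤ L := by omega
  exact Nat.cast_le.2 this

lemma abs_free_le (l : Fin (L + 1)) (m : ℕ) : |free l m| ≤ L := by
  rw [abs_of_nonneg (free_nonneg l m)]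
  exact free_le l m

lemma free_eq_zero {l : Fin (L + 1)} {m : ℕ} (hm : L + 1 ≤ m) : free l m = 0 := by
  have : (l - m : ℕ) = 0 := by omega
  simp [free, this]

lemma abs_transition_le {γ σ M : ℝ} {f : Fin (L + 1) → ℕ → ℝ} (hf : ∀ l m, |f l m| ≤ M)
    (l : Fin (L + 1)) (m : ℕ) : |transition γ σ f l m| ≤ M :=
  abs_mean_le _ fun _ => hf _ _

/-- Degrees never decrease, so the finitely supported test functions are stable under the transition
operator. This lets the induction over rounds close. -/
lemma transition_eq_zero {γ σ : ℝ} {B : ℕ} {f : Fin (L + 1) → ℕ → ℝ}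
    (z : ∀ l m, B ≤ m → f l m = 0) (l : Fin (L + 1)) {m : ℕ} (hm : B ≤ m) :
    transition γ σ f l m = 0 := by
  have : ∀ a, f l (m + a) = 0 := fun a => z _ _ (hm.trans (Nat.le_add_right _ _))
  simp only [transition, this, mean_const]

lemma abs_empirical_le {n : ℕ} (c : Fin n → Fin (L + 1)) (m : Fin n → ℕ) {M : ℝ}
    {f : Fin (L + 1) → ℕ → ℝ} (hf : ∀ l m, |f l m| ≤ M) : |empirical c m f| ≤ M := by
  have hM : 0 ≤ M := (abs_nonneg _).trans (hf 0 0)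
  rw [empirical, abs_div, Nat.abs_cast]
  refine div_le_of_le_mul₀ (Nat.cast_nonneg n) hM ?_
  refine (Finset.abs_sum_le_sum_abs _ _).trans ((Finset.sum_le_sum fun i _ => hf _ _).trans ?_)
  simp [mul_comm]

lemma abs_empirical_sub_le {n : ℕ} (c : Fin n → Fin (L + 1)) (m : Fin n → ℕ) {D : ℝ}
    {f g : Fin (L + 1) → ℕ → ℝ} (hf : ∀ l m, |f l m - g l m| ≤ D) :
    |empirical c m f - empirical c m g| ≤ D := by
  have := abs_empirical_le c m (f := fun l m => f l m - g l m) hf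
  rwa [empirical, Finset.sum_sub_distrib, sub_div] at this

lemma toNat_sub_cast (l : Fin (L + 1)) (m : ℕ) :
    ((((l : ℕ) : ℤ) - m).toNat : ℝ) = free l m := by
  rw [free]
  congr 1
  omega

section Fluctuation

variable {n : ℕ} (c : Fin n → Fin (L + 1)) (m : Fin n → ℕ)

lemma sum_free_eq (hn : 1 ≤ n) :
    ∑ i, ((((c i : ℕ) : ℤ) - m i).toNat : ℝ) = n * empirical c m free := by
  have : (n : ℝ) ≠ 0 := by positivity
  simp only [toNat_sub_cast, empirical]
  field_simp

lemma mul_weight_eq (hn : 1 ≤ n) (γ : ℝ) (i : Fin n) :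
    n * γ * weight (fun i => ((c i : ℕ) : ℤ) - m i) i =
      γ * free (c i) (m i) / empirical c m free := by
  have : (n : ℝ) ≠ 0 := by positivity
  rw [weight, sum_free_eq c m hn, toNat_sub_cast, mul_div_assoc', mul_assoc,
    mul_div_mul_left _ _ this]

/-- No node takes more than a share `O(1/n)` of the draws while the free sockets per node stay above
`ε`; hence the error `n * w ^ 2` is `O(1/n)`. -/
lemma weight_le (hn : 1 ≤ n) {ε : ℝ} (hε : 0 < ε) (h : ε ≤ empirical c m free) (i : Fin n) :
    weight (fun i => ((c i : ℕ) : ℤ) - m i) i ≤ L / (n * ε) := by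
  have : (0 : ℝ) < n := by positivity
  rw [weight, sum_free_eq c m hn, toNat_sub_cast]
  exact div_le_div₀ (Nat.cast_nonneg _) (free_le _ _) (by positivity) (by gcongr)

lemma exists_free (hn : 1 ≤ n) (h : 0 < empirical c m free) :
    ∃ i, 0 < ((c i : ℕ) : ℤ) - m i := by
  by_contra! hc
  have h0 := sum_free_eq c m hn
  rw [Finset.sum_eq_zero fun i _ => by simp [Int.toNat_of_nonpos (hc i)]] at h0
  have : (0 : ℝ) < n := by positivity
  linarith [mul_pos this h]

/-- The error in the Poisson approximation of one round. -/
noncomputable def roundError (P : ℝ[X]) (γ ε : ℝ) (B : ℕ) (M : ℝ) (L n : ℕ) : ℝ :=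
  B ^ 2 * M ^ 2 * (n * γ * P.natDegree * (4 * (L / (n * ε))) ^ 2)

lemma roundError_eq (P : ℝ[X]) (γ : ℝ) {ε : ℝ} (hε : 0 < ε) (B : ℕ) (M : ℝ) (L : ℕ)
    {n : ℕ} (hn : 1 ≤ n) :
    roundError P γ ε B M L n = 16 * B ^ 2 * M ^ 2 * γ * P.natDegree * L ^ 2 / ε ^ 2 / n := by
  have : (n : ℝ) ≠ 0 := by positivity
  rw [roundError]
  field_simp
  ring

variable {P : ℝ[X]} (hP : IsDegreeSequence P) {γ : ℝ} (hγ : 0 ≤ γ) {ε : ℝ} (hε : 0 < ε)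
  (hσ : ε ≤ empirical c m free) (hn : 1 ≤ n) {B : ℕ} (hB : 1 ≤ B) {M : ℝ} (hM : 1 ≤ M)
  {f : Fin (L + 1) → ℕ → ℝ} (hf : ∀ l m, |f l m| ≤ M) (z : ∀ l m, B ≤ m → f l m = 0)

include hP hγ hε hσ hn hB hM hf z in
lemma abs_mean_empirical_sub_le :
    |mean (roundLaw n P γ fun i => ((c i : ℕ) : ℤ) - m i)
        (fun R => empirical c (fun i => m i + R.count i) f) -
      empirical c m (transition γ (empirical c m free) f)| ≤ roundError P γ ε B M L n := by
  have hnR : (0 : ℝ) < n := by positivity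
  have e : mean (roundLaw n P γ fun i => ((c i : ℕ) : ℤ) - m i)
        (fun R => empirical c (fun i => m i + R.count i) f) =
      (∑ i, mean (roundLaw n P γ fun i => ((c i : ℕ) : ℤ) - m i)
        fun R => f (c i) (m i + R.count i)) / n := by
    simp only [empirical, div_eq_mul_inv]
    rw [mean_mul_const, mean_finsetSum _ _ (C := fun _ => M) fun i R => hf _ _]
  rw [e, empirical, ← sub_div, ← Finset.sum_sub_distrib, abs_div, Nat.abs_cast,
    div_le_iff₀ hnR]
  refine (Finset.abs_sum_le_sum_abs _ _).trans
    ((Finset.sum_le_sum fun i _ => ?_).trans_eq (b := ∑ i : Fin n, roundError P γ ε B M L n) ?_)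
  · rw [transition, ← mul_weight_eq c m hn]
    exact abs_mean_count_sub_le n hP hγ (exists_free c m hn (hε.trans_le hσ)) i
      (weight_le c m hn hε hσ) hB hM (f := fun a => f (c i) (m i + a)) (fun a => hf _ _)
      fun a ha => z _ _ (ha.trans (Nat.le_add_left _ _))
  · simp [mul_comm]

include hP hγ hε hσ hn hM hf z in
-- Expand the square as a double sum over nodes. Distinct nodes are nearly independent; each of the
-- `n` diagonal terms is bounded by `2 * M ^ 2`, which costs `2 * M ^ 2 / n` after division by `n ^
-- 2`.
lemma mean_empirical_sq_sub_le :
    mean (roundLaw n P γ fun i => ((c i : ℕ) : ℤ) - m i)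
        (fun R => empirical c (fun i => m i + R.count i) f ^ 2) -
      empirical c m (transition γ (empirical c m free) f) ^ 2 ≤
      roundError P γ ε B M L n + 2 * M ^ 2 / n := by
  have hnR : (0 : ℝ) < n := by positivity
  have hM0 : 0 ≤ M := by linarith
  set p := roundLaw n P γ fun i => ((c i : ℕ) : ℤ) - m i with hp
  set g := transition γ (empirical c m free) f with hg
  have hff : ∀ i j : Fin n, ∀ R : Round n P.natDegree,
      ‖f (c i) (m i + R.count i) * f (c j) (m j + R.count j)‖ ≤ M * M := fun i j R => by
    rw [norm_mul]
    exact mul_le_mul (hf _ _) (hf _ _) (norm_nonneg _) hM0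
  have e : mean p (fun R => empirical c (fun i => m i + R.count i) f ^ 2) =
      (∑ i, ∑ j, mean p fun R => f (c i) (m i + R.count i) * f (c j) (m j + R.count j)) /
        n ^ 2 := by
    simp only [empirical, div_pow]
    simp only [div_eq_mul_inv, sq (∑ i, _), Finset.sum_mul_sum]
    rw [mean_mul_const, mean_finsetSum _ _ (C := fun _ => ∑ j : Fin n, M * M)
      fun i R => norm_sum_le_of_le _ fun j _ => hff i j R]
    simp_rw [mean_finsetSum Finset.univ p (hff _)]
  have e' : empirical c m g ^ 2 = (∑ i, ∑ j, g (c i) (m i) * g (c j) (m j)) / n ^ 2 := by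
    rw [empirical, div_pow, sq (∑ i, _), Finset.sum_mul_sum]
  have hgM : ∀ l m, |g l m| ≤ M := abs_transition_le hf
  have key : ∀ i j : Fin n,
      (mean p fun R => f (c i) (m i + R.count i) * f (c j) (m j + R.count j)) -
        g (c i) (m i) * g (c j) (m j) ≤
      roundError P γ ε B M L n + if i = j then 2 * M ^ 2 else 0 := by
    intro i j
    have hr : 0 ≤ roundError P γ ε B M L n := by
      unfold roundError; positivity
    split_ifs with hij
    · have h1 := (le_abs_self _).trans (norm_mean_le p (hff i j))
      have h2 : |g (c i) (m i) * g (c j) (m j)| ≤ M * M := by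
        rw [abs_mul]
        exact mul_le_mul (hgM _ _) (hgM _ _) (abs_nonneg _) hM0
      linarith [(abs_le.1 h2).1, sq M]
    · rw [add_zero, hg, transition, transition, ← mul_weight_eq c m hn, ← mul_weight_eq c m hn]
      exact (le_abs_self _).trans
        (abs_mean_count_mul_sub_le n hP hγ (exists_free c m hn (hε.trans_le hσ)) hij
        (weight_le c m hn hε hσ) (f₁ := fun a => f (c i) (m i + a))
        (f₂ := fun a => f (c j) (m j + a)) (fun a => hf _ _) (fun a => hf _ _)
        (fun a ha => z _ _ (ha.trans (Nat.le_add_left _ _)))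
        fun a ha => z _ _ (ha.trans (Nat.le_add_left _ _)))
  rw [e, e', ← sub_div, div_le_iff₀ (by positivity), ← Finset.sum_sub_distrib]
  simp only [← Finset.sum_sub_distrib]
  refine (Finset.sum_le_sum fun i _ => Finset.sum_le_sum fun j _ => key i j).trans_eq ?_
  simp [Finset.sum_add_distrib]
  field_simp

end Fluctuation

/-- Poisson expectations are Lipschitz in the rate, and `σ / 2 ≤ τ` keeps the rate Lipschitz in `τ`.
It serves to replace the random number of free sockets by its limit. -/
lemma abs_transition_sub_le {γ : ℝ} (hγ : 0 ≤ γ) {σ τ : ℝ} (hσ : 0 < σ) (hτ : σ / 2 ≤ τ)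
    {B : ℕ} (hB : 1 ≤ B) {M : ℝ} (hM : 1 ≤ M)
    {f : Fin (L + 1) → ℕ → ℝ} (hf : ∀ l m, |f l m| ≤ M) (z : ∀ l m, B ≤ m → f l m = 0)
    (l : Fin (L + 1)) (m : ℕ) :
    |transition γ τ f l m - transition γ σ f l m| ≤
      B ^ 2 * M ^ 2 * (4 * γ * L / σ ^ 2) * |τ - σ| := by
  have hτ0 : 0 < τ := by linarith
  have hfr := free_nonneg l m
  refine (abs_mean_pois_sub_le (r := γ * free l m / τ) (s := γ * free l m / σ)
    (f := fun a => f l (m + a)) (by positivity) (by positivity) hB hM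
    (fun a => hf l (m + a)) fun a ha => z _ _ (ha.trans (Nat.le_add_left _ _))).trans ?_
  rw [mul_assoc _ _ |τ - σ|]
  refine mul_le_mul_of_nonneg_left ?_ (by positivity)
  have e : γ * free l m / τ - γ * free l m / σ = γ * free l m / (τ * σ) * (σ - τ) := by
    field_simp
  rw [e, abs_mul, abs_of_nonneg (by positivity), abs_sub_comm σ τ, ← mul_assoc]
  refine mul_le_mul_of_nonneg_right ?_ (abs_nonneg _)
  rw [mul_div_assoc', div_le_div_iff₀ (by positivity) (by positivity)]
  calc 2 * (γ * free l m) * σ ^ 2 ≤ 2 * (γ * L) * ((2 * τ) * σ) := by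
        rw [sq σ]
        have := free_le l m
        have : σ ≤ 2 * τ := by linarith
        gcongr
    _ = 4 * γ * L * (τ * σ) := by ring

/-- In one round the mean square distance of an empirical average from a value `y` grows by an
amount which is controlled by the fluctuation of the number of free sockets and by `1 / n`. -/
lemma exists_mean_sq_le {P : ℝ[X]} (hP : IsDegreeSequence P) {γ : ℝ} (hγ : 0 ≤ γ) {σ : ℝ}
    (hσ : 0 < σ) {B : ℕ} (hB : 1 ≤ B) {M : ℝ} (hM : 1 ≤ M) {f : Fin (L + 1) → ℕ → ℝ}
    (hf : ∀ l m, |f l m| ≤ M) (z : ∀ l m, B ≤ m → f l m = 0) {y : ℝ} (hy : |y| ≤ M) :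
    ∃ C : ℝ, 0 ≤ C ∧ ∀ (n : ℕ) (_ : 1 ≤ n) (c : Fin n → Fin (L + 1)) (m : Fin n → ℕ),
      mean (roundLaw n P γ fun i => ((c i : ℕ) : ℤ) - m i)
          (fun R => (empirical c (fun i => m i + R.count i) f - y) ^ 2) ≤
        2 * (empirical c m (transition γ σ f) - y) ^ 2 + C * (empirical c m free - σ) ^ 2 +
          C / n := by
  have hM0 : 0 ≤ M := by linarith
  set C₁ : ℝ := 16 * B ^ 2 * M ^ 2 * γ * P.natDegree * L ^ 2 / (σ / 2) ^ 2 with hC₁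
  set C₂ : ℝ := B ^ 2 * M ^ 2 * (4 * γ * L / σ ^ 2) with hC₂
  have hC₁0 : 0 ≤ C₁ := by positivity
  have hC₂0 : 0 ≤ C₂ := by positivity
  -- The summands pay, in order, for the Poisson approximation of the second and first moments, the
  -- diagonal, the passage from the actual to the limiting number of free sockets, and the case of
  -- too few free sockets.
  refine ⟨(1 + 2 * M) * C₁ + 2 * M ^ 2 + 2 * C₂ ^ 2 + 16 * M ^ 2 / σ ^ 2, by positivity, ?_⟩
  intro n hn c m
  have hnR : (0 : ℝ) < n := by positivity
  set p := roundLaw n P γ fun i => ((c i : ℕ) : ℤ) - m i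
  set C : ℝ := (1 + 2 * M) * C₁ + 2 * M ^ 2 + 2 * C₂ ^ 2 + 16 * M ^ 2 / σ ^ 2 with hC
  have hC0 : 0 ≤ C := by positivity
  have hX : ∀ R : Round n P.natDegree, |empirical c (fun i => m i + R.count i) f| ≤ M :=
    fun R => abs_empirical_le c _ hf
  -- With too few free sockets the Poisson approximation is unavailable, but then `(empirical c m
  -- free - σ) ^ 2 ≥ σ ^ 2 / 4`, and this term absorbs the trivial bound `(2 * M) ^ 2`.
  by_cases h : σ / 2 ≤ empirical c m free
  · have hr := roundError_eq P γ (half_pos hσ) B M L hn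
    have a1 := abs_mean_empirical_sub_le c m hP hγ (half_pos hσ) h hn hB hM hf z
    have a2 := mean_empirical_sq_sub_le c m hP hγ (half_pos hσ) h hn hM hf z
    rw [hr, ← hC₁] at a1 a2
    have a3 := abs_empirical_sub_le c m
      (abs_transition_sub_le (L := L) hγ hσ h hB hM hf z)
    rw [← hC₂] at a3
    set E₁ := mean p (fun R => empirical c (fun i => m i + R.count i) f)
    set E₂ := mean p (fun R => empirical c (fun i => m i + R.count i) f ^ 2)
    set τ := empirical c m free
    set Y := empirical c m (transition γ τ f)
    set Z := empirical c m (transition γ σ f)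
    have e : mean p (fun R => (empirical c (fun i => m i + R.count i) f - y) ^ 2) =
        E₂ - 2 * y * E₁ + y ^ 2 :=
      mean_sub_sq p hX y
    rw [e]
    have b1 : -(2 * y * (E₁ - Y)) ≤ 2 * M * (C₁ / n) := by
      refine (neg_le_abs _).trans ?_
      rw [abs_mul, abs_mul, abs_two]
      gcongr
    have b2 : (Y - y) ^ 2 ≤ 2 * (Z - y) ^ 2 + 2 * (C₂ ^ 2 * (τ - σ) ^ 2) := by
      have : (Y - Z) ^ 2 ≤ C₂ ^ 2 * (τ - σ) ^ 2 := by
        rw [← sq_abs, ← sq_abs (τ - σ), ← mul_pow]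
        exact pow_le_pow_left₀ (abs_nonneg _) a3 2
      nlinarith [sq_nonneg ((Y - Z) - (Z - y))]
    have b3 : (C₁ / n + 2 * M ^ 2 / n) + 2 * M * (C₁ / n) ≤ C / n := by
      rw [hC, mul_div_assoc', ← add_div, ← add_div]
      refine div_le_div_of_nonneg_right ?_ hnR.le
      have : 0 ≤ 2 * C₂ ^ 2 + 16 * M ^ 2 / σ ^ 2 := by positivity
      linarith
    have b4 : 2 * (C₂ ^ 2 * (τ - σ) ^ 2) ≤ C * (τ - σ) ^ 2 := by
      rw [← mul_assoc]
      refine mul_le_mul_of_nonneg_right ?_ (sq_nonneg _)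
      have : 0 ≤ (1 + 2 * M) * C₁ + 2 * M ^ 2 + 16 * M ^ 2 / σ ^ 2 := by positivity
      linarith
    linarith
  · have b1 : mean p (fun R => (empirical c (fun i => m i + R.count i) f - y) ^ 2) ≤ (2 * M) ^ 2 := by
      refine (le_abs_self _).trans (abs_mean_le p fun R => ?_)
      rw [abs_pow]
      refine pow_le_pow_left₀ (abs_nonneg _) ((abs_sub _ _).trans ?_) 2
      linarith [hX R]
    have b2 : (2 * M) ^ 2 ≤ 16 * M ^ 2 / σ ^ 2 * (empirical c m free - σ) ^ 2 := by
      have : (σ / 2) ^ 2 ≤ (empirical c m free - σ) ^ 2 := by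
        nlinarith
      calc (2 * M) ^ 2 = 16 * M ^ 2 / σ ^ 2 * (σ / 2) ^ 2 := by field_simp; ring
        _ ≤ _ := by gcongr
    have b3 : 16 * M ^ 2 / σ ^ 2 * (empirical c m free - σ) ^ 2 ≤
        C * (empirical c m free - σ) ^ 2 := by
      refine mul_le_mul_of_nonneg_right ?_ (sq_nonneg _)
      have : 0 ≤ (1 + 2 * M) * C₁ + 2 * M ^ 2 + 2 * C₂ ^ 2 := by positivity
      linarith
    have : 0 ≤ C / n := by positivity
    linarith [sq_nonneg (empirical c m (transition γ σ f) - y)]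

end OneRound

/-! ### The law of large numbers and the limiting profile -/

section Limit

/-- The joint limiting law of the class and of the degree of a variable node after `t` rounds. -/
noncomputable def limitLaw {L : ℕ} (p : PMF (Fin (L + 1))) (γ : ℝ) :
    ℕ → PMF (Fin (L + 1) × ℕ)
  | 0 => p.map fun l => (l, 0)
  | t + 1 => (limitLaw p γ t).bind fun x =>
      (pois (γ * free x.1 x.2 / mean (limitLaw p γ t) fun x => free x.1 x.2)).map
        fun a => (x.1, x.2 + a)

/-- The limiting number of free sockets per variable node after `t` rounds. -/
noncomputable def freeMean {L : ℕ} (p : PMF (Fin (L + 1))) (γ : ℝ) (t : ℕ) : ℝ :=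
  mean (limitLaw p γ t) fun x => free x.1 x.2

lemma mean_limitLaw_succ {L : ℕ} (p : PMF (Fin (L + 1))) (γ : ℝ) (t : ℕ)
    {f : Fin (L + 1) → ℕ → ℝ} {M : ℝ} (hf : ∀ l m, |f l m| ≤ M) :
    mean (limitLaw p γ (t + 1)) (fun x => f x.1 x.2) =
      mean (limitLaw p γ t) fun x => transition γ (freeMean p γ t) f x.1 x.2 := by
  have hf' : ∀ x : Fin (L + 1) × ℕ, ‖f x.1 x.2‖ ≤ M := fun x => hf _ _
  rw [limitLaw, mean_bind _ _ hf']
  simp only [mean_map _ _ hf']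
  rfl

lemma degree_append {n K : ℕ} (G : TannerGraph n K) (R : Round n K) (i : Fin n) :
    TannerGraph.degree (G ++ [R]) i = G.degree i + R.count i := by
  simp [TannerGraph.degree]

/-- The free socket numbers are a function of the graph, so the degrees alone describe the state to
which the one-round estimates apply. -/
lemma process_free (n : ℕ) (P : ℝ[X]) (γ : ℝ) (d₀ : Fin n → ℤ) (t : ℕ) :
    ∀ s ∈ (process n P γ d₀ t).support, s.2 = fun i => d₀ i - s.1.degree i := by
  induction t with
  | zero =>
    intro s hs
    rw [process, PMF.support_pure, Set.mem_singleton_iff] at hs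
    subst hs
    simp [TannerGraph.degree]
  | succ t ih =>
    intro s hs
    rw [process, PMF.mem_support_bind_iff] at hs
    obtain ⟨s', hs', hs⟩ := hs
    rw [PMF.mem_support_map_iff] at hs
    obtain ⟨R, -, rfl⟩ := hs
    funext i
    simp only [degree_append, ih s' hs']
    push_cast
    ring

lemma mean_process_succ (n : ℕ) (P : ℝ[X]) (γ : ℝ) (d₀ : Fin n → ℤ) (t : ℕ)
    {g : TannerGraph n P.natDegree × (Fin n → ℤ) → ℝ} {C : ℝ} (hg : ∀ s, ‖g s‖ ≤ C) :
    mean (process n P γ d₀ (t + 1)) g = mean (process n P γ d₀ t) fun s =>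
      mean (roundLaw n P γ s.2) fun R => g (s.1 ++ [R], fun i => s.2 i - R.count i) := by
  rw [process, mean_bind _ _ hg]
  simp only [mean_map _ _ hg]

/-- The law of the class of a random variable node. -/
noncomputable def classLaw {Λ : ℝ[X]} (hΛ : IsDegreeSequence Λ) : PMF (Fin (Λ.natDegree + 1)) :=
  PMF.ofFintype (fun l => ENNReal.ofReal (Λ.coeff l)) (by
    rw [← ENNReal.ofReal_sum_of_nonneg (f := fun l : Fin _ => Λ.coeff l) fun l _ => hΛ.nonneg l,
      Fin.sum_univ_eq_sum_range (fun l => Λ.coeff l), hΛ.sum_coeff, ENNReal.ofReal_one])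

lemma classLaw_toReal {Λ : ℝ[X]} (hΛ : IsDegreeSequence Λ) (l : Fin (Λ.natDegree + 1)) :
    (classLaw hΛ l).toReal = Λ.coeff l := by
  rw [classLaw, PMF.ofFintype_apply, ENNReal.toReal_ofReal (hΛ.nonneg l)]

lemma tendsto_largeBlocklength (Λ : ℝ[X]) :
    Tendsto (fun N : Fin (Λ.natDegree + 1) → ℕ => ∑ l, N l) (largeBlocklength Λ) atTop :=
  tendsto_comap.mono_left inf_le_left

lemma tendsto_div_largeBlocklength (Λ : ℝ[X]) (l : Fin (Λ.natDegree + 1)) :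
    Tendsto (fun N : Fin (Λ.natDegree + 1) → ℕ => (N l : ℝ) / ((∑ k, N k : ℕ) : ℝ))
      (largeBlocklength Λ) (𝓝 (Λ.coeff l)) := by
  have h : Tendsto (fun (N : Fin (Λ.natDegree + 1) → ℕ) (l : Fin (Λ.natDegree + 1)) =>
      (N l : ℝ) / ((∑ k, N k : ℕ) : ℝ)) (largeBlocklength Λ) (𝓝 fun l => Λ.coeff l) :=
    tendsto_comap.mono_left inf_le_right
  exact tendsto_pi_nhds.1 h l

/-- The initial average depends on the class sizes only, so convergence starts out uniform over the
partitions. -/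
lemma empirical_zero {L : ℕ} {N : Fin (L + 1) → ℕ} {c : Fin (∑ l, N l) → Fin (L + 1)}
    (hc : c ∈ partitions N) (f : Fin (L + 1) → ℕ → ℝ) :
    empirical c (fun _ => 0) f = ∑ l, (N l : ℝ) / ((∑ k, N k : ℕ) : ℝ) * f l 0 := by
  classical
  simp only [partitions, Finset.mem_filter, Finset.mem_univ, true_and] at hc
  rw [empirical, ← Finset.sum_fiberwise Finset.univ c, Finset.sum_div]
  refine Finset.sum_congr rfl fun l _ => ?_
  rw [Finset.sum_congr rfl (g := fun _ => f l 0), Finset.sum_const, nsmul_eq_mul, div_mul_eq_mul_div]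
  · congr 3
    convert hc l
  · intro i hi
    rw [(Finset.mem_filter.1 hi).2]

lemma abs_empirical_sub_sq_le {L n : ℕ} (c : Fin n → Fin (L + 1)) (m : Fin n → ℕ)
    {f : Fin (L + 1) → ℕ → ℝ} {M : ℝ} (hf : ∀ l m, |f l m| ≤ M) (y : ℝ) :
    |(empirical c m f - y) ^ 2| ≤ (M + |y|) ^ 2 := by
  rw [abs_pow]
  exact pow_le_pow_left₀ (abs_nonneg _)
    ((abs_sub _ _).trans (by linarith [abs_empirical_le c m hf])) 2

/-- Law of large numbers for the degrees in the multi-Poisson ensemble. -/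
lemma eventually_mean_sq_le {Λ P : ℝ[X]} (hΛ : IsDegreeSequence Λ) (hP : IsDegreeSequence P)
    {γ : ℝ} (hγ : 0 ≤ γ) (t : ℕ) (hσ : ∀ u < t, 0 < freeMean (classLaw hΛ) γ u) :
    ∀ (B : ℕ) (M : ℝ) (f : Fin (Λ.natDegree + 1) → ℕ → ℝ) (_ : ∀ l m, |f l m| ≤ M)
      (_ : ∀ l m, B ≤ m → f l m = 0) (ε : ℝ) (_ : 0 < ε),
      ∀ᶠ N in largeBlocklength Λ, ∀ c ∈ partitions N,
        mean (process (∑ l, N l) P γ (fun i => ((c i : ℕ) : ℤ)) t)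
          (fun s => (empirical c (fun i => s.1.degree i) f -
            mean (limitLaw (classLaw hΛ) γ t) fun x => f x.1 x.2) ^ 2) ≤ ε := by
  induction t with
  | zero =>
    intro B M f hf _ ε hε
    have hlim : mean (limitLaw (classLaw hΛ) γ 0) (fun x => f x.1 x.2) =
        ∑ l : Fin (Λ.natDegree + 1), Λ.coeff l * f l 0 := by
      have hf' : ∀ x : Fin (Λ.natDegree + 1) × ℕ, ‖f x.1 x.2‖ ≤ M := fun x => hf _ _
      rw [limitLaw, mean_map _ _ hf', mean, tsum_fintype]
      exact Finset.sum_congr rfl fun l _ => by rw [classLaw_toReal, smul_eq_mul]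
    have ht : Tendsto (fun N : Fin (Λ.natDegree + 1) → ℕ =>
        ((∑ l, (N l : ℝ) / ((∑ k, N k : ℕ) : ℝ) * f l 0) -
          ∑ l : Fin (Λ.natDegree + 1), Λ.coeff l * f l 0) ^ 2) (largeBlocklength Λ) (𝓝 0) := by
      have := ((tendsto_finsetSum Finset.univ fun l _ =>
        (tendsto_div_largeBlocklength Λ l).mul_const (f l 0)).sub_const
          (∑ l : Fin (Λ.natDegree + 1), Λ.coeff l * f l 0)).pow 2
      simpa using this
    filter_upwards [ht.eventually_le_const hε] with N hN c hc
    rw [process, mean_pure, hlim]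
    simpa [TannerGraph.degree, empirical_zero hc] using hN
  | succ t ih =>
    intro B M f hf z ε hε
    have ih' := ih fun u hu => hσ u (hu.trans (Nat.lt_succ_self t))
    set σ := freeMean (classLaw hΛ) γ t with hσdef
    have hf1 : ∀ l m, |f l m| ≤ max M 1 := fun l m => (hf l m).trans (le_max_left _ _)
    have z1 : ∀ l m, max B 1 ≤ m → f l m = 0 := fun l m hm => z l m ((le_max_left _ _).trans hm)
    set y := mean (limitLaw (classLaw hΛ) γ (t + 1)) (fun x => f x.1 x.2) with hy
    have hyK : y = mean (limitLaw (classLaw hΛ) γ t) fun x => transition γ σ f x.1 x.2 :=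
      mean_limitLaw_succ _ _ _ hf
    have hyM : |y| ≤ max M 1 := abs_mean_le _ fun x => hf1 _ _
    obtain ⟨C, hC, hstep⟩ := exists_mean_sq_le hP hγ (hσ t (Nat.lt_succ_self t))
      (le_max_right B 1) (le_max_right M 1) hf1 z1 hyM
    have hKf := abs_transition_le (γ := γ) (σ := σ) hf
    -- The one-round bound calls for two instances of the induction hypothesis: one for the
    -- transformed test function, one for `free`, which is itself finitely supported.
    have i1 := ih' B M (transition γ σ f) hKf (fun l m hm => transition_eq_zero z l hm) (ε / 8)
      (by positivity)
    have i2 := ih' (Λ.natDegree + 1) Λ.natDegree free abs_free_le (fun l m hm => free_eq_zero hm)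
      (ε / (4 * (C + 1))) (by positivity)
    have i3 : ∀ᶠ N in largeBlocklength Λ, C / ((∑ l, N l : ℕ) : ℝ) ≤ ε / 4 := by
      have := (tendsto_const_nhds (x := C)).div_atTop
        (tendsto_natCast_atTop_atTop.comp (tendsto_largeBlocklength Λ))
      exact this.eventually_le_const (by positivity)
    filter_upwards [i1, i2, i3, (tendsto_largeBlocklength Λ).eventually_ge_atTop 1]
      with N h1 h2 h3 hn c hc
    specialize h1 c hc
    specialize h2 c hc
    rw [mean_process_succ _ _ _ _ _ (C := (M + |y|) ^ 2)
      fun s => abs_empirical_sub_sq_le c _ hf y]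
    set p := process (∑ l, N l) P γ (fun i => ((c i : ℕ) : ℤ)) t with hp
    rw [← hyK] at h1
    change mean p (fun s => (empirical c (fun i => s.1.degree i) free - σ) ^ 2) ≤ _ at h2
    have b1 : ∀ s : TannerGraph (∑ l, N l) P.natDegree × (Fin (∑ l, N l) → ℤ),
        ‖2 * (empirical c (fun i => s.1.degree i) (transition γ σ f) - y) ^ 2‖ ≤
          2 * (M + |y|) ^ 2 := fun s => by
      rw [norm_mul, Real.norm_ofNat]
      exact mul_le_mul_of_nonneg_left (abs_empirical_sub_sq_le c _ hKf y) zero_le_two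
    have b2 : ∀ s : TannerGraph (∑ l, N l) P.natDegree × (Fin (∑ l, N l) → ℤ),
        ‖C * (empirical c (fun i => s.1.degree i) free - σ) ^ 2‖ ≤
          C * (Λ.natDegree + |σ|) ^ 2 := fun s => by
      rw [norm_mul, Real.norm_of_nonneg hC]
      exact mul_le_mul_of_nonneg_left (abs_empirical_sub_sq_le c _ abs_free_le σ) hC
    calc _ ≤ mean p (fun s =>
          2 * (empirical c (fun i => s.1.degree i) (transition γ σ f) - y) ^ 2 +
          C * (empirical c (fun i => s.1.degree i) free - σ) ^ 2 +
          C / ((∑ l, N l : ℕ) : ℝ)) := by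
          refine mean_mono p (C := (M + |y|) ^ 2)
            (D := 2 * (M + |y|) ^ 2 + C * (Λ.natDegree + |σ|) ^ 2 + ‖C / ((∑ l, N l : ℕ) : ℝ)‖)
            (fun s => ?_) (fun s => ?_) fun s hs => ?_
          · exact norm_mean_le _ fun R => abs_empirical_sub_sq_le c _ hf y
          · exact norm_add_le_of_le (norm_add_le_of_le (b1 s) (b2 s)) le_rfl
          · simp only [degree_append]
            rw [process_free _ _ _ _ _ s hs]
            exact hstep _ hn c fun i => s.1.degree i
      _ = 2 * mean p (fun s =>
            (empirical c (fun i => s.1.degree i) (transition γ σ f) - y) ^ 2) +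
          C * mean p (fun s => (empirical c (fun i => s.1.degree i) free - σ) ^ 2) +
          C / ((∑ l, N l : ℕ) : ℝ) := by
          rw [mean_add p (fun s => norm_add_le_of_le (b1 s) (b2 s)) (fun s => le_rfl),
            mean_add p b1 b2, mean_const, mean_const_mul, mean_const_mul]
      _ ≤ 2 * (ε / 8) + C * (ε / (4 * (C + 1))) + ε / 4 := by gcongr
      _ ≤ ε := by
          have : C * (ε / (4 * (C + 1))) ≤ ε / 4 := by
            rw [mul_div_assoc', div_le_div_iff₀ (by positivity) (by positivity)]
            nlinarith
          linarith

lemma mean_sub_const {β : Type} (p : PMF β) {f : β → ℝ} {C : ℝ} (hf : ∀ x, ‖f x‖ ≤ C) (y : ℝ) :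
    mean p (fun x => f x - y) = mean p f - y := by
  rw [mean_sub p hf (fun _ => le_refl ‖y‖), mean_const]

lemma degreeProfile_eq_empirical {L n K : ℕ} (c : Fin n → Fin (L + 1)) (G : TannerGraph n K)
    (l : ℕ) :
    G.degreeProfile l = empirical c (fun i => G.degree i) fun _ m => if m = l then 1 else 0 := by
  rw [TannerGraph.degreeProfile, empirical, Finset.sum_boole]

lemma abs_degreeProfile_le {n K : ℕ} (G : TannerGraph n K) (l : ℕ) : |G.degreeProfile l| ≤ 1 := by
  rw [degreeProfile_eq_empirical (L := 0) (fun _ => 0)]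
  refine abs_empirical_le _ _ fun _ m => ?_
  split_ifs <;> simp

lemma expectedDegreeProfile_eq (Λ P : ℝ[X]) (γ : ℝ) (N : Fin (Λ.natDegree + 1) → ℕ) (l : ℕ) :
    expectedDegreeProfile Λ P γ N l =
      mean (PMF.uniformOfFinset (partitions N) (partitions_nonempty N)) fun c =>
        mean (process (∑ l, N l) P γ (fun i => ((c i : ℕ) : ℤ)) (rounds Λ γ))
          fun s => s.1.degreeProfile l := by
  have hb : ∀ G : TannerGraph (∑ l, N l) P.natDegree, ‖G.degreeProfile l‖ ≤ 1 := fun G =>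
    abs_degreeProfile_le G l
  rw [expectedDegreeProfile, expect_eq_mean, ensemble, mean_bind _ _ hb]
  simp only [mean_map _ _ hb]

/-- The expected degree profile converges as the blocklength tends to infinity. -/
lemma tendsto_expectedDegreeProfile {Λ P : ℝ[X]} (hΛ : IsDegreeSequence Λ)
    (hP : IsDegreeSequence P) {γ : ℝ} (hγ : 0 ≤ γ)
    (hσ : ∀ u < rounds Λ γ, 0 < freeMean (classLaw hΛ) γ u) (l : ℕ) :
    Tendsto (fun N => expectedDegreeProfile Λ P γ N l) (largeBlocklength Λ)
      (𝓝 (mean (limitLaw (classLaw hΛ) γ (rounds Λ γ)) fun x => if x.2 = l then 1 else 0)) := by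
  set f : Fin (Λ.natDegree + 1) → ℕ → ℝ := fun _ m => if m = l then 1 else 0 with hfdef
  have hf : ∀ l m, |f l m| ≤ 1 := fun l m => by
    simp only [hfdef]
    split_ifs <;> simp
  have z : ∀ l' m, l + 1 ≤ m → f l' m = 0 := fun _ m hm => if_neg (by omega)
  set y := mean (limitLaw (classLaw hΛ) γ (rounds Λ γ)) fun x => f x.1 x.2 with hy
  change Tendsto _ _ (𝓝 y)
  rw [Metric.tendsto_nhds]
  intro ε hε
  filter_upwards [eventually_mean_sq_le hΛ hP hγ (rounds Λ γ) hσ (l + 1) 1 f hf z ((ε / 2) ^ 2)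
    (by positivity)] with N hN
  rw [Real.dist_eq, expectedDegreeProfile_eq]
  have h1 := mean_sub_const (PMF.uniformOfFinset (partitions N) (partitions_nonempty N))
    (f := fun c => mean (process (∑ l, N l) P γ (fun i => ((c i : ℕ) : ℤ)) (rounds Λ γ))
      fun s => s.1.degreeProfile l) (C := 1)
    (fun c => norm_mean_le _ fun s => abs_degreeProfile_le s.1 l) y
  rw [← h1]
  refine (abs_mean_le_of_support _ (half_pos hε).le fun c hc => ?_).trans_lt (half_lt_self hε)
  rw [PMF.mem_support_uniformOfFinset_iff] at hc
  have h2 := mean_sub_const (process (∑ l, N l) P γ (fun i => ((c i : ℕ) : ℤ)) (rounds Λ γ))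
    (f := fun s => s.1.degreeProfile l) (C := 1) (fun s => abs_degreeProfile_le s.1 l) y
  rw [← h2]
  -- Mean square convergence controls the mean, since `(E X) ^ 2 ≤ E X ^ 2`.
  refine abs_le_of_sq_le_sq ((sq_mean_le _ (M := 1 + |y|) fun s => ?_).trans ?_) (half_pos hε).le
  · exact (abs_sub _ _).trans (add_le_add (abs_degreeProfile_le s.1 l) le_rfl)
  · simp only [degreeProfile_eq_empirical c]
    exact hN c hc

end Limit

/-! ### The limiting recursion for small `γ` -/

section Estimates

lemma pois_toReal {r : ℝ} (hr : 0 ≤ r) (a : ℕ) :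
    (pois r a).toReal = Real.exp (-r) * r ^ a / a.factorial := by
  rw [pois, poissonPMF_apply_toReal, Real.coe_toNNReal r hr]

lemma mean_pois_indicator {r : ℝ} (hr : 0 ≤ r) (k : ℕ) :
    mean (pois r) (fun a => if a = k then (1 : ℝ) else 0) =
      Real.exp (-r) * r ^ k / k.factorial := by
  rw [mean, tsum_eq_single k fun a ha => by rw [if_neg ha, smul_zero], if_pos rfl, pois_toReal hr]
  simp

lemma mean_pois_zero (f : ℕ → ℝ) : mean (pois 0) f = f 0 := by
  rw [mean, tsum_eq_single 0 fun a ha => by simp [pois_toReal le_rfl, ha], pois_toReal le_rfl]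
  simp

/-- The Poisson identity `(a + 1) p(a + 1) = r p(a)` turns the series for the mean into `r`.
Boundedness of `h` guarantees summability. -/
lemma mean_pois_le {r : ℝ} (hr : 0 ≤ r) {h : ℕ → ℝ} {C : ℝ} (hC : ∀ a, |h a| ≤ C)
    (h1 : ∀ a, h a ≤ a) : mean (pois r) h ≤ r := by
  have hs := summable_mean (pois r) (f := h) hC
  have hs' := (summable_toReal (pois r)).mul_left r
  have e : 0 + ∑' a, r * (pois r a).toReal = r := by
    rw [tsum_mul_left, tsum_toReal, mul_one, zero_add]
  rw [mean, hs.tsum_eq_zero_add]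
  refine le_of_le_of_eq ?_ e
  refine add_le_add (mul_nonpos_of_nonneg_of_nonpos ENNReal.toReal_nonneg (by simpa using h1 0))
    (((summable_nat_add_iff 1).2 hs).tsum_le_tsum (fun a => ?_) hs')
  rw [smul_eq_mul]
  refine (mul_le_mul_of_nonneg_left (h1 (a + 1)) ENNReal.toReal_nonneg).trans_eq ?_
  rw [pois_toReal hr, pois_toReal hr, Nat.factorial_succ]
  push_cast
  field_simp
  ring

lemma mean_pois_le_of_step {r : ℝ} (hr : 0 ≤ r) {h : ℕ → ℝ} {C : ℝ} (hC : ∀ a, |h a| ≤ C)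
    {A₀ A₁ A₂ : ℝ} (h0 : h 0 ≤ A₀) (h1 : h 1 ≤ A₁) (h2 : ∀ a, 2 ≤ a → h a ≤ A₂) :
    mean (pois r) h ≤
      A₂ + (A₀ - A₂) * Real.exp (-r) + (A₁ - A₂) * (Real.exp (-r) * r) := by
  have hi : ∀ (c : ℝ) (k a : ℕ), ‖c * (if a = k then (1 : ℝ) else 0)‖ ≤ |c| := fun c k a => by
    split_ifs <;> simp
  have e : mean (pois r) (fun a => A₂ + (A₀ - A₂) * (if a = 0 then (1 : ℝ) else 0) +
        (A₁ - A₂) * (if a = 1 then (1 : ℝ) else 0)) =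
      A₂ + (A₀ - A₂) * Real.exp (-r) + (A₁ - A₂) * (Real.exp (-r) * r) := by
    rw [mean_add (pois r) (f := fun a => A₂ + (A₀ - A₂) * (if a = 0 then (1 : ℝ) else 0))
        (fun a => norm_add_le_of_le le_rfl (hi _ _ a)) (hi _ _),
      mean_add (pois r) (fun a => le_rfl) (hi _ _), mean_const, mean_const_mul, mean_const_mul,
      mean_pois_indicator hr, mean_pois_indicator hr]
    simp
  rw [← e]
  refine mean_mono (pois r) hC
    (fun a => norm_add_le_of_le (norm_add_le_of_le le_rfl (hi _ _ a)) (hi _ _ a)) fun a _ => ?_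
  rcases a with _ | _ | a
  · simpa using h0
  · simpa using h1
  · simpa using h2 (a + 2) (by omega)

variable {L : ℕ}

lemma free_pos_or (l : Fin (L + 1)) (m : ℕ) :
    (free l m = 0 ∧ (l : ℕ) ≤ m) ∨ ((m : ℕ) < l ∧ free l m = (l : ℝ) - m) := by
  rcases le_or_gt (l : ℕ) m with h | h
  · exact Or.inl ⟨by simp [free, Nat.sub_eq_zero_of_le h], h⟩
  · exact Or.inr ⟨h, by rw [free, Nat.cast_sub h.le]⟩

/-- Each draw uses up at most one free socket. -/
lemma sub_le_transition_free {γ σ : ℝ} (hγ : 0 ≤ γ) (hσ : 0 < σ) (l : Fin (L + 1)) (m : ℕ) :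
    free l m - γ * free l m / σ ≤ transition γ σ free l m := by
  have hfr := free_nonneg l m
  have hr : 0 ≤ γ * free l m / σ := by positivity
  have h := mean_pois_le hr (h := fun a => free l m - free l (m + a)) (C := L + L)
    (fun a => (abs_sub _ _).trans (add_le_add (abs_free_le _ _) (abs_free_le _ _))) fun a => by
      rw [sub_le_iff_le_add]
      have : (l - m : ℕ) ≤ a + (l - (m + a) : ℕ) := by omega
      unfold free
      exact_mod_cast this
  rw [mean_sub _ (f := fun _ => free l m) (fun _ => abs_free_le _ _) (fun _ => abs_free_le _ _),
    mean_const] at h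
  rw [transition]
  linarith

lemma exp_neg_le {r : ℝ} (hr : 0 ≤ r) : Real.exp (-r) ≤ 1 - r + r ^ 2 := by
  rw [Real.exp_neg, inv_le_comm₀ (Real.exp_pos _) (by nlinarith [sq_nonneg (r - 1)])]
  refine le_trans ?_ (Real.add_one_le_exp r)
  rw [inv_le_iff_one_le_mul₀ (by nlinarith [sq_nonneg (r - 1)])]
  nlinarith [pow_nonneg hr 3]

/-- Only one of the two factors `free` is bounded by `L`: averaging the other gives `σ`, which
improves `γ ^ 2 / σ ^ 2` to `γ ^ 2 / σ`. -/
lemma rate_sq_le {γ σ : ℝ} (hσ : 0 < σ) (l : Fin (L + 1)) (m : ℕ) :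
    (γ * free l m / σ) ^ 2 ≤ γ ^ 2 * L / σ ^ 2 * free l m := by
  have h1 := free_nonneg l m
  have h2 := free_le l m
  rw [div_pow, mul_pow, div_mul_eq_mul_div]
  refine div_le_div_of_nonneg_right ?_ (by positivity)
  rw [sq (free l m), mul_assoc]
  gcongr

/-- A node with a free socket loses at least one as soon as it is drawn, which has probability `1 -
exp (-r) ≥ r - r ^ 2`. -/
lemma transition_free_le {γ σ : ℝ} (hγ : 0 ≤ γ) (hσ : 0 < σ) (l : Fin (L + 1)) (m : ℕ) :
    transition γ σ free l m ≤
      free l m - γ * free l m / σ + γ ^ 2 * L / σ ^ 2 * free l m := by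
  have hfr := free_nonneg l m
  have hr : 0 ≤ γ * free l m / σ := by positivity
  refine le_trans ?_ (add_le_add_right (rate_sq_le hσ l m) _)
  rcases free_pos_or l m with ⟨h0, -⟩ | ⟨hm, h0⟩
  · rw [transition, h0]
    simp [mean_pois_zero, h0]
  · have hstep : ∀ a, 1 ≤ a → free l (m + a) ≤ free l m - 1 := fun a ha => by
      rw [le_sub_iff_add_le]
      have : (l - (m + a) : ℕ) + 1 ≤ (l - m : ℕ) := by omega
      unfold free
      exact_mod_cast this
    refine (mean_pois_le_of_step hr (h := fun a => free l (m + a)) (fun a => abs_free_le _ _)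
      le_rfl (hstep 1 le_rfl) fun a ha => hstep a (by omega)).trans ?_
    have := exp_neg_le hr
    simp only [add_zero]
    linarith

/-- The indicator of the event that a node has more edges than sockets. -/
def excess (l : Fin (L + 1)) (m : ℕ) : ℝ := if (l : ℕ) < m then 1 else 0

lemma abs_excess_le (l : Fin (L + 1)) (m : ℕ) : |excess l m| ≤ 1 := by
  unfold excess
  split_ifs <;> simp

/-- A node with a free socket needs at least two draws to become overfull, an event of probability
at most `r ^ 2`; a node without one has rate `0` and stays as it is. -/
lemma transition_excess_le {γ σ : ℝ} (hγ : 0 ≤ γ) (hσ : 0 < σ) (l : Fin (L + 1)) (m : ℕ) :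
    transition γ σ excess l m ≤ excess l m + γ ^ 2 * L / σ ^ 2 * free l m := by
  have hfr := free_nonneg l m
  have hr : 0 ≤ γ * free l m / σ := by positivity
  refine le_trans ?_ (add_le_add_right (rate_sq_le hσ l m) _)
  rcases free_pos_or l m with ⟨h0, -⟩ | ⟨hm, -⟩
  · rw [transition, h0]
    simp [mean_pois_zero]
  · have hz : ∀ a, a ≤ 1 → excess l (m + a) = 0 := fun a ha => if_neg (by omega)
    refine (mean_pois_le_of_step hr (h := fun a => excess l (m + a)) (fun a => abs_excess_le _ _)
      (hz 0 (by omega)).le (hz 1 le_rfl).le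
      fun a _ => (abs_le.1 (abs_excess_le l (m + a))).2).trans ?_
    have h1 : excess l m = 0 := hz 0 (by omega)
    have h2 := Real.add_one_le_exp (-(γ * free l m / σ))
    rw [h1]
    nlinarith

variable (p : PMF (Fin (L + 1))) {γ : ℝ}

lemma abs_mul_free_le (c : ℝ) (x : Fin (L + 1) × ℕ) : ‖c * free x.1 x.2‖ ≤ |c| * L := by
  rw [norm_mul]
  exact mul_le_mul_of_nonneg_left (abs_free_le _ _) (abs_nonneg _)

lemma sub_le_freeMean_succ (hγ : 0 ≤ γ) {t : ℕ} (hσ : 0 < freeMean p γ t) :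
    freeMean p γ t - γ ≤ freeMean p γ (t + 1) := by
  set σ := freeMean p γ t with hσdef
  have e : mean (limitLaw p γ t) (fun x => (1 - γ / σ) * free x.1 x.2) = σ - γ := by
    rw [mean_const_mul]
    change (1 - γ / σ) * σ = σ - γ
    field_simp
  rw [freeMean, mean_limitLaw_succ p γ t abs_free_le, ← e]
  refine mean_mono _ (abs_mul_free_le _) (fun x => abs_transition_le abs_free_le _ _) fun x _ => ?_
  refine le_trans (le_of_eq ?_) (sub_le_transition_free hγ hσ x.1 x.2)
  ring

lemma freeMean_succ_le (hγ : 0 ≤ γ) {t : ℕ} (hσ : 0 < freeMean p γ t) :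
    freeMean p γ (t + 1) ≤ freeMean p γ t - γ + γ ^ 2 * L / freeMean p γ t := by
  set σ := freeMean p γ t with hσdef
  have e : mean (limitLaw p γ t) (fun x => (1 - γ / σ + γ ^ 2 * L / σ ^ 2) * free x.1 x.2) =
      σ - γ + γ ^ 2 * L / σ := by
    rw [mean_const_mul]
    change (1 - γ / σ + γ ^ 2 * L / σ ^ 2) * σ = _
    field_simp
  rw [freeMean, mean_limitLaw_succ p γ t abs_free_le, ← e]
  refine mean_mono _ (fun x => abs_transition_le abs_free_le _ _) (abs_mul_free_le _) fun x _ => ?_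
  refine (transition_free_le hγ hσ x.1 x.2).trans_eq ?_
  ring

/-- The limiting fraction of nodes with more edges than sockets. -/
noncomputable def excessMean (t : ℕ) : ℝ := mean (limitLaw p γ t) fun x => excess x.1 x.2

lemma excessMean_succ_le (hγ : 0 ≤ γ) {t : ℕ} (hσ : 0 < freeMean p γ t) :
    excessMean p (γ := γ) (t + 1) ≤
      excessMean p (γ := γ) t + γ ^ 2 * L / freeMean p γ t := by
  set σ := freeMean p γ t with hσdef
  have e : mean (limitLaw p γ t)
        (fun x => excess x.1 x.2 + γ ^ 2 * L / σ ^ 2 * free x.1 x.2) =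
      excessMean p (γ := γ) t + γ ^ 2 * L / σ := by
    rw [mean_add _ (fun x => abs_excess_le _ _) (abs_mul_free_le _), mean_const_mul]
    change _ + γ ^ 2 * L / σ ^ 2 * σ = _ + _
    congr 1
    field_simp
  rw [excessMean, mean_limitLaw_succ p γ t abs_excess_le, ← e]
  exact mean_mono _ (fun x => abs_transition_le abs_excess_le _ _)
    (fun x => norm_add_le_of_le (abs_excess_le _ _) (abs_mul_free_le _ x))
    fun x _ => transition_excess_le hγ hσ x.1 x.2

/-- Makes the sum of `1 / (T + 1 - t)` telescope. Square roots lose against the logarithm, but still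
give a power of `γ`. -/
lemma inv_le_sqrt_sub {x : ℝ} (hx : 1 ≤ x) : 1 / x ≤ 2 * (√x - √(x - 1)) := by
  have h0 : 0 < √x := Real.sqrt_pos.2 (by linarith)
  have h1 : √x ^ 2 = x := Real.sq_sqrt (by linarith)
  have h2 : √(x - 1) ^ 2 = x - 1 := Real.sq_sqrt (by linarith)
  have h3 : √(x - 1) ≤ √x := Real.sqrt_le_sqrt (by linarith)
  have h4 : 1 ≤ √x := Real.one_le_sqrt.2 hx
  have h5 : 1 ≤ 2 * (√x - √(x - 1)) * √x := by
    nlinarith [Real.sqrt_nonneg (x - 1), sq_nonneg (√x - √(x - 1))]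
  rw [div_le_iff₀ (by linarith)]
  nlinarith [Real.sqrt_nonneg (x - 1)]

/-- As long as `γ (T + 1)` does not exceed the initial number of sockets per node, the number of
free sockets decreases almost linearly. -/
lemma freeMean_bounds (hγ : 0 < γ) {T : ℕ} (hT : γ * (T + 1) ≤ freeMean p γ 0) (t : ℕ)
    (ht : t ≤ T) :
    freeMean p γ 0 - γ * t ≤ freeMean p γ t ∧
    freeMean p γ t ≤ freeMean p γ 0 - γ * t +
      γ * L * (2 * (√(T + 1) - √(T + 1 - t))) ∧
    excessMean p (γ := γ) t ≤ excessMean p (γ := γ) 0 +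
      γ * L * (2 * (√(T + 1) - √(T + 1 - t))) := by
  induction t with
  | zero => simp
  | succ t ih =>
    obtain ⟨h1, h2, h3⟩ := ih (by omega)
    have htT : (t : ℝ) + 1 ≤ T := by exact_mod_cast ht
    -- The lower bound needs no error term, so it can be fed into the denominators of the two upper
    -- bounds.
    have hlow : γ * (T + 1 - t) ≤ freeMean p γ t := by linarith
    have hx : (1 : ℝ) ≤ T + 1 - t := by linarith
    have hpos : 0 < freeMean p γ t := lt_of_lt_of_le (by positivity) hlow
    have hb : γ ^ 2 * L / freeMean p γ t ≤
        γ * L * (2 * (√(T + 1 - t) - √(T + 1 - t - 1))) := by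
      calc γ ^ 2 * L / freeMean p γ t ≤ γ ^ 2 * L / (γ * (T + 1 - t)) := by gcongr
        _ = γ * L * (1 / (T + 1 - t)) := by
          have : (T : ℝ) + 1 - t ≠ 0 := by linarith
          field_simp
        _ ≤ _ := by
          have := inv_le_sqrt_sub hx
          gcongr
    have e : (T : ℝ) + 1 - t - 1 = T + 1 - (t + 1 : ℕ) := by push_cast; ring
    rw [e] at hb
    have i1 := sub_le_freeMean_succ p hγ.le hpos
    have i2 := freeMean_succ_le p hγ.le hpos
    have i3 := excessMean_succ_le p hγ.le hpos
    have e' : γ * ((t + 1 : ℕ) : ℝ) = γ * t + γ := by push_cast; ring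
    rw [e']
    refine ⟨by linarith, ?_, ?_⟩ <;> linarith

lemma excessMean_zero : excessMean p (γ := γ) 0 = 0 := by
  have h : ∀ x : Fin (L + 1) × ℕ, ‖excess x.1 x.2‖ ≤ 1 := fun x => abs_excess_le _ _
  rw [excessMean, limitLaw, mean_map _ _ h]
  simp [excess, mean_const]

/-- The class of a node never changes. -/
lemma mean_limitLaw_fst {g : Fin (L + 1) → ℝ} {M : ℝ} (hg : ∀ l, |g l| ≤ M) (t : ℕ) :
    mean (limitLaw p γ t) (fun x => g x.1) = mean p g := by
  induction t with
  | zero =>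
    have hg' : ∀ x : Fin (L + 1) × ℕ, ‖g x.1‖ ≤ M := fun x => hg _
    rw [limitLaw, mean_map _ _ hg']
  | succ t ih =>
    rw [mean_limitLaw_succ p γ t (f := fun l _ => g l) fun l _ => hg l, ← ih]
    simp only [transition, mean_const]

/-- A degree below the class leaves at least one free socket; a degree above it is an excess. -/
lemma mean_mismatch_le (t : ℕ) :
    mean (limitLaw p γ t) (fun x => if x.2 = x.1 then 0 else 1) ≤
      freeMean p γ t + excessMean p (γ := γ) t := by
  rw [freeMean, excessMean, ← mean_add _ (f := fun x : Fin (L + 1) × ℕ => free x.1 x.2)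
    (fun x => abs_free_le _ _) (fun x => abs_excess_le _ _)]
  refine mean_mono _ (C := 1) (fun x => ?_)
    (fun x => norm_add_le_of_le (abs_free_le _ _) (abs_excess_le _ _)) fun x _ => ?_
  · split_ifs <;> simp
  · rcases lt_trichotomy x.2 (x.1 : ℕ) with h | h | h
    · rw [if_neg h.ne, excess, if_neg h.le.not_gt, add_zero, free]
      have : 1 ≤ (x.1 - x.2 : ℕ) := by omega
      exact_mod_cast this
    · rw [if_pos h, excess, if_neg h.not_gt, add_zero]
      exact free_nonneg _ _
    · rw [if_neg h.ne', excess, if_pos h]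
      linarith [free_nonneg x.1 x.2]

lemma sum_abs_indicator_sub_le (s : Finset ℕ) (a b : ℕ) :
    ∑ l ∈ s, |(if a = l then (1 : ℝ) else 0) - (if b = l then 1 else 0)| ≤
      2 * if a = b then 0 else 1 := by
  by_cases h : a = b
  · simp [h]
  · rw [if_neg h]
    calc _ ≤ ∑ l ∈ s, ((if a = l then (1 : ℝ) else 0) + (if b = l then 1 else 0)) := by
          refine Finset.sum_le_sum fun l _ => ?_
          split_ifs <;> norm_num
      _ ≤ 1 + 1 := by
          rw [Finset.sum_add_distrib, Finset.sum_ite_eq, Finset.sum_ite_eq]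
          gcongr <;> split_ifs <;> norm_num
      _ = _ := by norm_num

lemma abs_mean_sub_mean_le {β : Type} (q : PMF β) {f g : β → ℝ} {C D : ℝ} (hf : ∀ x, ‖f x‖ ≤ C)
    (hg : ∀ x, ‖g x‖ ≤ D) : |mean q f - mean q g| ≤ mean q fun x => |f x - g x| := by
  have h1 : ∀ x, ‖f x - g x‖ ≤ C + D := fun x => norm_sub_le_of_le (hf x) (hg x)
  have h2 : ∀ x, ‖|f x - g x|‖ ≤ C + D := fun x => (norm_norm _).trans_le (h1 x)
  have h3 : ∀ x, ‖-1 * |f x - g x|‖ ≤ C + D := fun x => by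
    rw [norm_mul, norm_neg, norm_one, one_mul]
    exact h2 x
  rw [← mean_sub q hf hg, abs_le]
  constructor
  · rw [← neg_one_mul, ← mean_const_mul]
    exact mean_mono q h3 h1 fun x _ => by rw [neg_one_mul]; exact neg_abs_le _
  · exact mean_mono q h1 h2 fun x _ => le_abs_self _

/-- Coupling bound: `limitLaw` is a joint law of class and degree, so the two marginals differ by at
most twice the probability of a mismatch. Uniformity in `s` later yields summability and the bound
on the full series. -/
lemma sum_abs_sub_le (s : Finset ℕ) (t : ℕ) :
    ∑ l ∈ s, |mean (limitLaw p γ t) (fun x => if x.2 = l then (1 : ℝ) else 0) -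
        mean p (fun x => if (x : ℕ) = l then (1 : ℝ) else 0)| ≤
      2 * mean (limitLaw p γ t) (fun x => if x.2 = x.1 then 0 else 1) := by
  have hi : ∀ a l : ℕ, ‖if a = l then (1 : ℝ) else 0‖ ≤ 1 := fun a l => by
    split_ifs <;> simp
  have hd' : ∀ a b l : ℕ, ‖|(if a = l then (1 : ℝ) else 0) - (if b = l then 1 else 0)|‖ ≤ 1 :=
    fun a b l => by split_ifs <;> simp
  calc _ ≤ ∑ l ∈ s, mean (limitLaw p γ t) fun x =>
        |(if x.2 = l then (1 : ℝ) else 0) - (if (x.1 : ℕ) = l then 1 else 0)| := by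
        refine Finset.sum_le_sum fun l _ => ?_
        rw [← mean_limitLaw_fst p (γ := γ) (g := fun x => if (x : ℕ) = l then (1 : ℝ) else 0)
          (fun x => hi x l) t]
        exact abs_mean_sub_mean_le (limitLaw p γ t)
          (f := fun x : Fin (L + 1) × ℕ => if x.2 = l then (1 : ℝ) else 0)
          (g := fun x : Fin (L + 1) × ℕ => if (x.1 : ℕ) = l then (1 : ℝ) else 0)
          (fun x => hi x.2 l) fun x => hi x.1 l
    _ = mean (limitLaw p γ t) fun x => ∑ l ∈ s,
        |(if x.2 = l then (1 : ℝ) else 0) - (if (x.1 : ℕ) = l then 1 else 0)| :=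
        (mean_finsetSum s (limitLaw p γ t) (C := fun _ => 1)
          (f := fun (l : ℕ) (x : Fin (L + 1) × ℕ) =>
            |(if x.2 = l then (1 : ℝ) else 0) - (if (x.1 : ℕ) = l then 1 else 0)|)
          fun l x => hd' x.2 x.1 l).symm
    _ ≤ mean (limitLaw p γ t) fun x => 2 * if x.2 = x.1 then 0 else 1 :=
        mean_mono (limitLaw p γ t) (C := ∑ l ∈ s, 1) (D := 2)
          (f := fun x : Fin (L + 1) × ℕ => ∑ l ∈ s,
            |(if x.2 = l then (1 : ℝ) else 0) - (if (x.1 : ℕ) = l then 1 else 0)|)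
          (g := fun x : Fin (L + 1) × ℕ => 2 * if x.2 = x.1 then 0 else 1)
          (fun x => norm_sum_le_of_le _ fun l _ => hd' x.2 x.1 l)
          (fun x => by split_ifs <;> simp)
          fun x _ => sum_abs_indicator_sub_le s x.2 x.1
    _ = _ := mean_const_mul _ _ _

end Estimates

/-! ### The number of rounds and the final bound -/

section Main

variable {Λ P : ℝ[X]} {γ : ℝ}

lemma mean_classLaw (hΛ : IsDegreeSequence Λ) (g : ℕ → ℝ) :
    mean (classLaw hΛ) (fun l => g l) =
      ∑ l ∈ Finset.range (Λ.natDegree + 1), Λ.coeff l * g l := by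
  rw [← Fin.sum_univ_eq_sum_range (fun l => Λ.coeff l * g l), mean, tsum_fintype]
  exact Finset.sum_congr rfl fun l _ => by rw [classLaw_toReal, smul_eq_mul]

lemma mean_classLaw_indicator (hΛ : IsDegreeSequence Λ) (l : ℕ) :
    mean (classLaw hΛ) (fun x => if (x : ℕ) = l then (1 : ℝ) else 0) = Λ.coeff l := by
  rw [mean_classLaw hΛ fun x => if x = l then (1 : ℝ) else 0]
  simp only [mul_ite, mul_one, mul_zero, Finset.sum_ite_eq', Finset.mem_range]
  split_ifs with h
  · rfl
  · exact (Polynomial.coeff_eq_zero_of_natDegree_lt (by omega)).symm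

lemma freeMean_zero (hΛ : IsDegreeSequence Λ) :
    freeMean (classLaw hΛ) γ 0 = Λ.derivative.eval 1 := by
  have h : ∀ x : Fin (Λ.natDegree + 1) × ℕ, ‖free x.1 x.2‖ ≤ Λ.natDegree := fun x =>
    abs_free_le _ _
  rw [freeMean, limitLaw, mean_map _ _ h, derivative_eval_one]
  simp only [free, Nat.sub_zero]
  rw [mean_classLaw hΛ fun l => (l : ℝ)]
  exact Finset.sum_congr rfl fun l _ => mul_comm _ _

/-- The truncated subtraction in `rounds` is harmless: `Λ'(1) ≥ 2 > γ` makes the floor at least `1`.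
-/
lemma rounds_add_one (hΛ : IsDegreeSequence Λ) (hγ : γ ∈ Set.Ioo (0 : ℝ) 1) :
    rounds Λ γ + 1 = ⌊Λ.derivative.eval 1 / γ⌋₊ := by
  have : 1 ≤ ⌊Λ.derivative.eval 1 / γ⌋₊ := by
    rw [Nat.one_le_floor_iff, one_le_div hγ.1]
    linarith [hγ.2, hΛ.two_le_derivative]
  rw [rounds]
  omega

lemma mul_rounds_le (hΛ : IsDegreeSequence Λ) (hγ : γ ∈ Set.Ioo (0 : ℝ) 1) :
    γ * (rounds Λ γ + 1) ≤ Λ.derivative.eval 1 := by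
  have h : ((rounds Λ γ : ℝ) + 1) ≤ Λ.derivative.eval 1 / γ := by
    have := Nat.floor_le (div_nonneg (by linarith [hΛ.two_le_derivative]) hγ.1.le :
      0 ≤ Λ.derivative.eval 1 / γ)
    rw [← rounds_add_one hΛ hγ] at this
    exact_mod_cast this
  rwa [le_div_iff₀ hγ.1, mul_comm] at h

lemma sub_mul_rounds_le (hΛ : IsDegreeSequence Λ) (hγ : γ ∈ Set.Ioo (0 : ℝ) 1) :
    Λ.derivative.eval 1 - γ * rounds Λ γ ≤ 2 * γ := by
  have h := (Nat.lt_floor_add_one (Λ.derivative.eval 1 / γ)).le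
  rw [← rounds_add_one hΛ hγ, div_le_iff₀ hγ.1] at h
  push_cast at h
  linarith

/-- Stopping one round before the floor keeps `σ_t ≥ Λ'(1) - γ t > 0`, so every rate `γ * free /
σ_t` that is used has a positive denominator. -/
lemma freeMean_pos (hΛ : IsDegreeSequence Λ) (hγ : γ ∈ Set.Ioo (0 : ℝ) 1) {t : ℕ}
    (ht : t < rounds Λ γ) :
    0 < freeMean (classLaw hΛ) γ t := by
  have h0 := mul_rounds_le hΛ hγ
  have h := (freeMean_bounds (classLaw hΛ) hγ.1 (by rw [freeMean_zero]; exact h0) t ht.le).1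
  rw [freeMean_zero] at h
  have : (t : ℝ) < rounds Λ γ := by exact_mod_cast ht
  nlinarith [hγ.1]

/-- Nontriviality of the filter makes the limit unique, so `limUnder` takes this value. -/
lemma limitDegreeProfile_eq (hΛ : IsDegreeSequence Λ) (hP : IsDegreeSequence P)
    (hγ : γ ∈ Set.Ioo (0 : ℝ) 1) (l : ℕ) :
    limitDegreeProfile Λ P γ l =
      mean (limitLaw (classLaw hΛ) γ (rounds Λ γ)) fun x => if x.2 = l then 1 else 0 :=
  haveI := largeBlocklength_neBot hΛ
  (tendsto_expectedDegreeProfile hΛ hP hγ.1.le (fun _ hu => freeMean_pos hΛ hγ hu) l).limUnder_eq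

lemma sum_abs_limitDegreeProfile_sub_le (hΛ : IsDegreeSequence Λ) (hP : IsDegreeSequence P)
    (hγ : γ ∈ Set.Ioo (0 : ℝ) 1) (s : Finset ℕ) :
    ∑ l ∈ s, |limitDegreeProfile Λ P γ l - Λ.coeff l| ≤
      (4 + 8 * Λ.natDegree * √(Λ.derivative.eval 1)) * √γ := by
  set T := rounds Λ γ with hT
  set D := Λ.derivative.eval 1 with hD
  have hγ0 := hγ.1
  have h0 : γ * (T + 1) ≤ D := mul_rounds_le hΛ hγ
  have h1 : D - γ * T ≤ 2 * γ := sub_mul_rounds_le hΛ hγ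
  obtain ⟨-, h2, h3⟩ := freeMean_bounds (classLaw hΛ) hγ0 (by rw [freeMean_zero]; exact h0) T le_rfl
  rw [freeMean_zero, ← hD] at h2
  rw [excessMean_zero, zero_add] at h3
  have h4 := sum_abs_sub_le (classLaw hΛ) (γ := γ) s T
  have h5 := mean_mismatch_le (classLaw hΛ) (γ := γ) T
  simp only [mean_classLaw_indicator] at h4
  simp only [limitDegreeProfile_eq hΛ hP hγ, ← hT]
  have hsq : √γ * √γ = γ := Real.mul_self_sqrt hγ0.le
  -- The source of the exponent `1/2`: since `γ (T + 1) ≤ D`, the telescoped error `γ √(T + 1)` is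
  -- of order `√γ`.
  have h6 : γ * √(T + 1) ≤ √D * √γ := by
    calc γ * √((T : ℝ) + 1) = √(γ * (T + 1)) * √γ := by
          rw [Real.sqrt_mul hγ0.le, mul_right_comm, hsq]
      _ ≤ _ := by gcongr
  have h7 : γ ≤ √γ := by
    have : √γ ≤ 1 := Real.sqrt_le_one.2 hγ.2.le
    nlinarith [Real.sqrt_nonneg γ]
  have h8 : γ * Λ.natDegree * (2 * (√(T + 1) - √((T : ℝ) + 1 - T))) ≤
      2 * Λ.natDegree * (√D * √γ) := by
    have h9 : γ * (√(T + 1) - √((T : ℝ) + 1 - T)) ≤ √D * √γ := by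
      nlinarith [Real.sqrt_nonneg ((T : ℝ) + 1 - T)]
    have := mul_le_mul_of_nonneg_left h9 (by positivity : (0 : ℝ) ≤ 2 * Λ.natDegree)
    linarith
  -- The free part is at most `2 γ + 2 L √D √γ` and the excess at most `2 L √D √γ`, where `L` is the
  -- degree of `Λ`; the coupling bound doubles their sum, and `γ ≤ √γ`.
  nlinarith

end Main

end MultiPoisson

open MultiPoisson
theorem mainTheorem5 (Λ P : ℝ[X]) (hΛ : IsDegreeSequence Λ) (hP : IsDegreeSequence P) :
    (∀ γ ∈ Set.Ioo (0 : ℝ) 1, ∀ l : ℕ,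
      Tendsto (fun N => expectedDegreeProfile Λ P γ N l) (largeBlocklength Λ)
        (𝓝 (limitDegreeProfile Λ P γ l))) ∧
    (∃ A > (0 : ℝ), ∃ b > (0 : ℝ), ∀ γ ∈ Set.Ioo (0 : ℝ) 1, ∀ l ∈ Finset.Icc 2 Λ.natDegree,
      |limitDegreeProfile Λ P γ l - Λ.coeff l| ≤ A * γ ^ b) ∧
    (∀ γ ∈ Set.Ioo (0 : ℝ) 1, Summable fun l : ℕ => |limitDegreeProfile Λ P γ l - Λ.coeff l|) ∧
    Tendsto (fun γ : ℝ => 1 / 2 * ∑' l : ℕ, |limitDegreeProfile Λ P γ l - Λ.coeff l|)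
      (𝓝[>] 0) (𝓝 0) := by
  have hsum := fun {γ : ℝ} (hγ : γ ∈ Set.Ioo (0 : ℝ) 1) (s : Finset ℕ) =>
    sum_abs_limitDegreeProfile_sub_le hΛ hP hγ s
  set A := 4 + 8 * Λ.natDegree * √(Λ.derivative.eval 1)
  refine ⟨fun γ hγ l => ?_, ⟨A, by positivity, 1 / 2, by norm_num, fun γ hγ l _ => ?_⟩,
    fun γ hγ => summable_of_sum_le (fun _ => abs_nonneg _) (hsum hγ), ?_⟩
  · rw [limitDegreeProfile_eq hΛ hP hγ]
    exact tendsto_expectedDegreeProfile hΛ hP hγ.1.le (fun _ hu => freeMean_pos hΛ hγ hu) l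
  · rw [← Real.sqrt_eq_rpow]
    simpa using hsum hγ {l}
  · have hlim : Tendsto (fun γ : ℝ => 1 / 2 * (A * √γ)) (𝓝[>] 0) (𝓝 0) := by
      have : Continuous fun γ : ℝ => 1 / 2 * (A * √γ) := by fun_prop
      simpa using (this.tendsto 0).mono_left nhdsWithin_le_nhds
    refine squeeze_zero' (Eventually.of_forall fun γ => ?_) ?_ hlim
    · exact mul_nonneg (by norm_num) (tsum_nonneg fun _ => abs_nonneg _)
    · filter_upwards [Ioo_mem_nhdsGT (zero_lt_one' ℝ)] with γ hγ
      exact mul_le_mul_of_nonneg_left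
        (Real.tsum_le_of_sum_le (fun _ => abs_nonneg _) (hsum hγ)) (by norm_num)
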